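/- Let $V$ be a finite-dimensional complex vector space and let $G\le GL(V)$ be an irreducible finite complex reflection group, i.e. $G$ is finite, acts irreducibly on $V$, and is generated by the set $\mathcal S=\{s\in G:\dim(1-s)V=1\}$ of its complex reflections. For $s\in\mathcal S$ choose a root $\alpha_s\in V^*$ and a coroot $\check\alpha_s\in V$ such that $s(v)=v-\langle\alpha_s,v\rangle\check\alpha_s$ for all $v\in V$. Let $c\colon\mathcal S\to\mathbb C$, $s\mapsto c_s$, satisfy $c_{gsg^{-1}}=c_s$ for all $g\in G$, $s\in\mathcal S$. The algebra $H_{0,c}(G)$ is generated by $V$, $G$ and $V^*$ with the relations of $G$ and, for $v,v'\in V$, $f,f'\in V^*$, $g\in G$, the relations $[v,v']=0$, $[f,f']=0$, $gv=g(v)g$, $gf=g(f)g$ and $[f,v]=\sum_{s\in\mathcal S}c_s\langle f,(1-s)v\rangle s$. The restricted Cherednik algebra is $\overline H_{0,c}(G)=H_{0,c}(G)/\langle S(V)^G_+,S(V^*)^G_+\rangle$, where $S(V)^G_+$ denotes the $G$-invariants in $S(V)$ with zero constant term, and the coinvariant algebra is $S(V)_G=S(V)/\langle S(V)^G_+\rangle$.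 Let $Y_G$ be the vector space with basis $\{[s]:s\in\mathcal S\}$, with $G$-action $g([s])=\lambda(g,s)[gsg^{-1}]$, where $g(\check\alpha_s)=\lambda(g,s)\check\alpha_{gsg^{-1}}$, and with braiding $\Psi([r]\otimes[s])=r([s])\otimes[r]$; let $\{[s]^*\}$ be the dual basis of $Y_G^*$, with the contragredient $G$-action and the adjoint braiding $\Psi^*$ (for the pairing $\langle f\otimes f',y\otimes y'\rangle=\langle f,y\rangle\langle f',y'\rangle$). For a braided space $(Y,\Psi)$ put $[n]_\Psi=\mathrm{id}+\Psi_{n-1,n}+\Psi_{n-1,n}\Psi_{n-2,n-1}+\dots+\Psi_{n-1,n}\cdots\Psi_{1,2}$ and $[n]!_\Psi=([1]_\Psi\otimes\mathrm{id}^{\otimes n-1})([2]_\Psi\otimes\mathrm{id}^{\otimes n-2})\cdots[n]_\Psi$ on $Y^{\otimes n}$, and let $\mathcal B(Y)=T(Y)/\bigoplus_n\ker[n]!_\Psi$ be the Nichols–Woronowicz algebra. The braided Heisenberg double $\mathcal H_{Y_G}$ is the algebra generated by $[s]$, $[s]^*$ ($s\in\mathcal S$) and $G$, with the relations of $G$,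 of $\mathcal B(Y_G)$ among the $[s]$, and of $\mathcal B(Y_G^*)$ among the $[s]^*$, together with $g\cdot[s]=g([s])\cdot g$, $g\cdot[s]^*=g([s]^*)\cdot g$, and $[r]^*[s]-[s][r]^*=s$ if $r=s$ and $0$ otherwise. Then the assignment $$M_c(v)=\sum_{s\in\mathcal S}c_s\langle\alpha_s,v\rangle[s],\qquad M_c(f)=\sum_{s\in\mathcal S}\langle f,\check\alpha_s\rangle[s]^*,\qquad M_c(g)=g\qquad(v\in V,\ f\in V^*,\ g\in G)$$ extends to an algebra homomorphism $M_c\colon\overline H_{0,c}(G)\to\mathcal H_{Y_G}$. For generic $c$ the homomorphism $M_c$ is injective: namely if $c_s\ne0$ for all $s\in\mathcal S$ and, more generally, if the reflections $s$ with $c_s\neq 0$ generate $G$. In particular, the map $v\mapsto\sum_{s}c_s\langle\alpha_s,v\rangle[s]$ extends to an algebra homomorphism $S(V)_G\to\mathcal B(Y_G)$, which is injective under the same condition on $c$, so that the coinvariant algebra embeds in $\mathcal B(Y_G)$. -/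

import Mathlib

noncomputable section

namespace Cherednik

open scoped Matrix

/-! ### Braidings in coordinates and Nichols-Woronowicz algebras -/

section Braided

variable {ι : Type*} [Fintype ι] [DecidableEq ι]

/-- Leg notation. A linear endomorphism `Ψ` of `Y ⊗ Y`, where `Y` has basis `e_i` (`i : ι`), is
given by its matrix: `Ψ (e_i ⊗ e_j) = ∑ Ψ (k, l) (i, j) e_k ⊗ e_l`. The `n`-th tensor power of `Y`
has as basis the words `w : Fin n → ι`, and `leg Ψ n p q` is the matrix of `Ψ` applied at the
tensor positions `p` and `q`. -/
def leg (Ψ : Matrix (ι × ι) (ι × ι) ℂ) (n : ℕ) (p q : Fin n) :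
    Matrix (Fin n → ι) (Fin n → ι) ℂ :=
  Matrix.of fun u w =>
    if ∀ k : Fin n, k ≠ p → k ≠ q → u k = w k then Ψ (u p, u q) (w p, w q) else 0

/-- `Ψ` applied at the (zero-based) positions `i`, `i + 1` of the `n`-th tensor power. Positions
that do not exist are never used below. -/
def adjLeg (Ψ : Matrix (ι × ι) (ι × ι) ℂ) (n i : ℕ) : Matrix (Fin n → ι) (Fin n → ι) ℂ :=
  if h : i + 1 < n then leg Ψ n ⟨i, Nat.lt_of_succ_lt h⟩ ⟨i + 1, h⟩ else 1

/-- The braided integer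
`[m] = 1 + Ψ_{m-1,m} + Ψ_{m-1,m} Ψ_{m-2,m-1} + ⋯ + Ψ_{m-1,m} ⋯ Ψ_{1,2}` (one-based positions),
acting on the first `m` tensor factors of the `n`-th tensor power. -/
def braidedInt (Ψ : Matrix (ι × ι) (ι × ι) ℂ) (n m : ℕ) : Matrix (Fin n → ι) (Fin n → ι) ℂ :=
  ∑ k ∈ Finset.range m, ((List.range k).map fun j => adjLeg Ψ n (m - 2 - j)).prod

/-- The braided factorial `[n]! = ([1] ⊗ id) ([2] ⊗ id) ⋯ [n]`, which is the degree `n` component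
of the Woronowicz symmetriser of `Ψ`. -/
def braidedFactorial (Ψ : Matrix (ι × ι) (ι × ι) ℂ) (n : ℕ) :
    Matrix (Fin n → ι) (Fin n → ι) ℂ :=
  ((List.range n).map fun m => braidedInt Ψ n (m + 1)).prod

/-- The noncommutative homogeneous polynomial `∑ a_w x_{w_1} ⋯ x_{w_n}`. -/
def wordSum {A : Type*} [Ring A] [Algebra ℂ A] (x : ι → A) {n : ℕ} (a : (Fin n → ι) → ℂ) : A :=
  ∑ w : Fin n → ι, a w • (List.ofFn fun k => x (w k)).prod

/-- The relations of the Nichols-Woronowicz algebra: the (graded) kernel of the Woronowicz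
symmetriser in the tensor algebra, i.e. in the free algebra on the basis. -/
inductive NicholsRel (Ψ : Matrix (ι × ι) (ι × ι) ℂ) : FreeAlgebra ℂ ι → FreeAlgebra ℂ ι → Prop
  | ker (n : ℕ) (a : (Fin n → ι) → ℂ) (h : braidedFactorial Ψ n *ᵥ a = 0) :
      NicholsRel Ψ (wordSum (FreeAlgebra.ι ℂ) a) 0

/-- The Nichols-Woronowicz algebra of the space with basis `ι` and braiding `Ψ`. -/
abbrev Nichols (Ψ : Matrix (ι × ι) (ι × ι) ℂ) := RingQuot (NicholsRel Ψ)

/-- The generator of the Nichols-Woronowicz algebra given by a basis vector. -/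
def Nichols.gen (Ψ : Matrix (ι × ι) (ι × ι) ℂ) (i : ι) : Nichols Ψ :=
  RingQuot.mkAlgHom ℂ (NicholsRel Ψ) (FreeAlgebra.ι ℂ i)

end Braided

/-! ### Coinvariant algebras -/

section Coinvariants

variable {Γ W : Type*} [Group Γ] [AddCommGroup W] [Module ℂ W]

/-- The action of a group element on the symmetric algebra of a representation. -/
def symAct (ρ : Representation ℂ Γ W) (g : Γ) :
    SymmetricAlgebra ℂ W →ₐ[ℂ] SymmetricAlgebra ℂ W :=
  SymmetricAlgebra.lift (SymmetricAlgebra.ι ℂ W ∘ₗ ρ g)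

/-- The invariants in the symmetric algebra with zero constant term. -/
def posInvariants (ρ : Representation ℂ Γ W) : Set (SymmetricAlgebra ℂ W) :=
  {p | (∀ g, symAct ρ g p = p) ∧ SymmetricAlgebra.algebraMapInv p = 0}

/-- The coinvariant algebra: the symmetric algebra modulo the ideal generated by the invariants
with zero constant term. -/
abbrev Coinvariant (ρ : Representation ℂ Γ W) :=
  SymmetricAlgebra ℂ W ⧸ Ideal.span (posInvariants ρ)

end Coinvariants

/-! ### Complex reflections -/

variable {V : Type*} [AddCommGroup V] [Module ℂ V]

/-- The tautological representation of a linear group. -/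
def natRep (G : Subgroup (LinearMap.GeneralLinearGroup ℂ V)) : Representation ℂ G V :=
  (Units.coeHom (V →ₗ[ℂ] V)).comp G.subtype

/-- `s` is a complex reflection: `dim (1 - s) V = 1`. -/
def IsReflection {G : Subgroup (LinearMap.GeneralLinearGroup ℂ V)} (s : G) : Prop :=
  Module.finrank ℂ (LinearMap.range (1 - natRep G s)) = 1

/-- The set of complex reflections in `G`. -/
def Refl (G : Subgroup (LinearMap.GeneralLinearGroup ℂ V)) := {s : G // IsReflection s}

instance (G : Subgroup (LinearMap.GeneralLinearGroup ℂ V)) : DecidableEq (Refl G) :=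
  Classical.decEq _

instance (G : Subgroup (LinearMap.GeneralLinearGroup ℂ V)) [Finite G] : Fintype (Refl G) :=
  @Fintype.ofFinite _ (inferInstanceAs (Finite {s : G // IsReflection s}))

variable {G : Subgroup (LinearMap.GeneralLinearGroup ℂ V)}

theorem IsReflection.conj {s : G} (hs : IsReflection s) (g : G) : IsReflection (g * s * g⁻¹) := by
  have key : (1 - natRep G (g * s * g⁻¹) : V →ₗ[ℂ] V)
      = natRep G g ∘ₗ (1 - natRep G s) ∘ₗ natRep G g⁻¹ := by
    change _ = natRep G g * ((1 - natRep G s) * natRep G g⁻¹)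
    rw [sub_mul, mul_sub, one_mul, ← map_mul, ← map_mul, ← map_mul, mul_inv_cancel, map_one,
      mul_assoc]
  have hinv : ∀ h : G, natRep G h ∘ₗ natRep G h⁻¹ = LinearMap.id := fun h => by
    change natRep G h * natRep G h⁻¹ = 1
    rw [← map_mul, mul_inv_cancel, map_one]
  have hinj : Function.Injective (natRep G g) := by
    have h := hinv g⁻¹
    rw [inv_inv] at h
    exact Function.LeftInverse.injective (g := natRep G g⁻¹) fun v => LinearMap.congr_fun h v
  have hsurj : Function.Surjective (natRep G g⁻¹) := by
    have h := hinv g⁻¹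
    rw [inv_inv] at h
    exact Function.RightInverse.surjective (g := natRep G g) fun v => LinearMap.congr_fun h v
  unfold IsReflection at hs ⊢
  rw [key, LinearMap.range_comp, LinearMap.range_comp_of_range_eq_top _
    (LinearMap.range_eq_top.2 hsurj), ← hs]
  exact (Submodule.equivMapOfInjective _ hinj _).finrank_eq.symm

/-- The conjugate `g s g⁻¹` of a complex reflection. -/
def Refl.conj (g : G) (s : Refl G) : Refl G := ⟨g * s.1 * g⁻¹, s.2.conj g⟩

variable (G) in
/-- A choice of roots `α_s ∈ V*` and coroots `α̌_s ∈ V` of all complex reflections: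
`s(v) = v - ⟨α_s, v⟩ α̌_s`. -/
structure RootData where
  /-- the root `α_s` -/
  root : Refl G → Module.Dual ℂ V
  /-- the coroot `α̌_s` -/
  coroot : Refl G → V
  /-- the defining property -/
  apply_eq : ∀ (s : Refl G) (v : V), natRep G s.1 v = v - root s v • coroot s

namespace RootData

variable (R : RootData G)

theorem exists_cocycle (g : G) (s : Refl G) :
    ∃ l : ℂ, natRep G g (R.coroot s) = l • R.coroot (s.conj g) := by
  have hne : ∃ v, R.root s v ≠ 0 := by
    by_contra! h
    have h0 : (1 - natRep G s.1 : V →ₗ[ℂ] V) = 0 := by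
      ext v
      simp [R.apply_eq, h]
    have hs : Module.finrank ℂ (LinearMap.range (1 - natRep G s.1)) = 1 := s.2
    rw [h0, LinearMap.range_zero, finrank_bot] at hs
    exact zero_ne_one hs
  obtain ⟨v, hv⟩ := hne
  refine ⟨(R.root s v)⁻¹ * R.root (s.conj g) (natRep G g v), ?_⟩
  have h1 := R.apply_eq (s.conj g) (natRep G g v)
  have h2 : natRep G (s.conj g).1 (natRep G g v) = natRep G g (natRep G s.1 v) := by
    change (natRep G (g * s.1 * g⁻¹) * natRep G g) v = (natRep G g * natRep G s.1) v
    rw [← map_mul, ← map_mul, inv_mul_cancel_right]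
  rw [h2, R.apply_eq s v, map_sub, map_smul, sub_right_inj] at h1
  rw [mul_smul, ← h1, inv_smul_smul₀ hv]

/-- The scalar `λ(g, s)` with `g(α̌_s) = λ(g, s) α̌_{g s g⁻¹}`. -/
def cocycle (g : G) (s : Refl G) : ℂ := (R.exists_cocycle g s).choose

theorem cocycle_spec (g : G) (s : Refl G) :
    natRep G g (R.coroot s) = R.cocycle g s • R.coroot (s.conj g) :=
  (R.exists_cocycle g s).choose_spec

/-- The Yetter-Drinfeld module `Y_G` has basis `[s]`, indexed by the complex reflections, with
`[s]` in degree `s` and action `g([s]) = λ(g, s) [g s g⁻¹]`. This is the matrix of its braiding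
`Ψ ([r] ⊗ [s]) = r([s]) ⊗ [r] = λ(r, s) [r s r⁻¹] ⊗ [r]`. -/
def braiding : Matrix (Refl G × Refl G) (Refl G × Refl G) ℂ :=
  Matrix.of fun kl rs =>
    if kl.1 = rs.2.conj rs.1.1 ∧ kl.2 = rs.1 then R.cocycle rs.1.1 rs.2 else 0

end RootData

/-! ### The braided Heisenberg double of `Y_G` -/

variable (G) in
/-- Generators of the braided Heisenberg double: `[s]`, the group elements, and the elements
`[s]*` of the dual basis. -/
inductive HeisGen
  | y (s : Refl G)
  | grp (g : G)
  | ystar (s : Refl G)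

/-- Defining relations of the braided Heisenberg double `B(Y_G) ⋊ ℂG ⋉ B(Y_G*)`. In the dual basis
`[s]*` the adjoint braiding `Ψ*` on `Y_G*` has the transposed matrix, and the contragredient action
is `g([s]*) = λ(g, s)⁻¹ [g s g⁻¹]*`. -/
inductive HeisRel [Finite G] (R : RootData G) :
    FreeAlgebra ℂ (HeisGen G) → FreeAlgebra ℂ (HeisGen G) → Prop
  | ker (n : ℕ) (a : (Fin n → Refl G) → ℂ) (h : braidedFactorial R.braiding n *ᵥ a = 0) :
      HeisRel R (wordSum (fun s => FreeAlgebra.ι ℂ (HeisGen.y s)) a) 0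
  | ker_star (n : ℕ) (a : (Fin n → Refl G) → ℂ) (h : braidedFactorial R.braidingᵀ n *ᵥ a = 0) :
      HeisRel R (wordSum (fun s => FreeAlgebra.ι ℂ (HeisGen.ystar s)) a) 0
  | grp_one : HeisRel R (FreeAlgebra.ι ℂ (.grp 1)) 1
  | grp_mul (g h : G) :
      HeisRel R (FreeAlgebra.ι ℂ (.grp (g * h)))
        (FreeAlgebra.ι ℂ (.grp g) * FreeAlgebra.ι ℂ (.grp h))
  | grp_y (g : G) (s : Refl G) :
      HeisRel R (FreeAlgebra.ι ℂ (.grp g) * FreeAlgebra.ι ℂ (.y s))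
        (R.cocycle g s • (FreeAlgebra.ι ℂ (.y (s.conj g)) * FreeAlgebra.ι ℂ (.grp g)))
  | grp_ystar (g : G) (s : Refl G) :
      HeisRel R (FreeAlgebra.ι ℂ (.grp g) * FreeAlgebra.ι ℂ (.ystar s))
        ((R.cocycle g s)⁻¹ • (FreeAlgebra.ι ℂ (.ystar (s.conj g)) * FreeAlgebra.ι ℂ (.grp g)))
  | comm (r s : Refl G) :
      HeisRel R
        (FreeAlgebra.ι ℂ (.ystar r) * FreeAlgebra.ι ℂ (.y s)
          - FreeAlgebra.ι ℂ (.y s) * FreeAlgebra.ι ℂ (.ystar r))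
        (if r = s then FreeAlgebra.ι ℂ (.grp s.1) else 0)

/-- The braided Heisenberg double attached to `Y_G`. -/
abbrev HeisDouble [Finite G] (R : RootData G) := RingQuot (HeisRel R)

namespace HeisDouble

variable [Finite G] (R : RootData G)

/-- The generator `[s]`. -/
def y (s : Refl G) : HeisDouble R := RingQuot.mkAlgHom ℂ (HeisRel R) (FreeAlgebra.ι ℂ (.y s))

/-- The generator `[s]*`. -/
def ystar (s : Refl G) : HeisDouble R :=
  RingQuot.mkAlgHom ℂ (HeisRel R) (FreeAlgebra.ι ℂ (.ystar s))

/-- The group element `g`. -/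
def grp (g : G) : HeisDouble R := RingQuot.mkAlgHom ℂ (HeisRel R) (FreeAlgebra.ι ℂ (.grp g))

end HeisDouble

/-! ### Rational and restricted Cherednik algebras -/

variable (G) in
/-- Generators of the rational Cherednik algebra: vectors, group elements, linear forms. -/
inductive CherGen
  | vec (v : V)
  | grp (g : G)
  | cov (f : Module.Dual ℂ V)

/-- Defining relations of the rational Cherednik algebra `H_{t,c}(G)`. -/
inductive CherRel [Finite G] (t : ℂ) (c : Refl G → ℂ) :
    FreeAlgebra ℂ (CherGen G) → FreeAlgebra ℂ (CherGen G) → Prop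
  | vec_add (v w : V) :
      CherRel t c (FreeAlgebra.ι ℂ (.vec (v + w)))
        (FreeAlgebra.ι ℂ (.vec v) + FreeAlgebra.ι ℂ (.vec w))
  | vec_smul (z : ℂ) (v : V) :
      CherRel t c (FreeAlgebra.ι ℂ (.vec (z • v))) (z • FreeAlgebra.ι ℂ (.vec v))
  | cov_add (f f' : Module.Dual ℂ V) :
      CherRel t c (FreeAlgebra.ι ℂ (.cov (f + f')))
        (FreeAlgebra.ι ℂ (.cov f) + FreeAlgebra.ι ℂ (.cov f'))
  | cov_smul (z : ℂ) (f : Module.Dual ℂ V) :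
      CherRel t c (FreeAlgebra.ι ℂ (.cov (z • f))) (z • FreeAlgebra.ι ℂ (.cov f))
  | grp_one : CherRel t c (FreeAlgebra.ι ℂ (.grp 1)) 1
  | grp_mul (g h : G) :
      CherRel t c (FreeAlgebra.ι ℂ (.grp (g * h)))
        (FreeAlgebra.ι ℂ (.grp g) * FreeAlgebra.ι ℂ (.grp h))
  | vec_comm (v w : V) :
      CherRel t c (FreeAlgebra.ι ℂ (.vec v) * FreeAlgebra.ι ℂ (.vec w))
        (FreeAlgebra.ι ℂ (.vec w) * FreeAlgebra.ι ℂ (.vec v))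
  | cov_comm (f f' : Module.Dual ℂ V) :
      CherRel t c (FreeAlgebra.ι ℂ (.cov f) * FreeAlgebra.ι ℂ (.cov f'))
        (FreeAlgebra.ι ℂ (.cov f') * FreeAlgebra.ι ℂ (.cov f))
  | grp_vec (g : G) (v : V) :
      CherRel t c (FreeAlgebra.ι ℂ (.grp g) * FreeAlgebra.ι ℂ (.vec v))
        (FreeAlgebra.ι ℂ (.vec (natRep G g v)) * FreeAlgebra.ι ℂ (.grp g))
  | grp_cov (g : G) (f : Module.Dual ℂ V) :
      CherRel t c (FreeAlgebra.ι ℂ (.grp g) * FreeAlgebra.ι ℂ (.cov f))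
        (FreeAlgebra.ι ℂ (.cov ((natRep G).dual g f)) * FreeAlgebra.ι ℂ (.grp g))
  | cov_vec (f : Module.Dual ℂ V) (v : V) :
      CherRel t c
        (FreeAlgebra.ι ℂ (.cov f) * FreeAlgebra.ι ℂ (.vec v)
          - FreeAlgebra.ι ℂ (.vec v) * FreeAlgebra.ι ℂ (.cov f))
        (algebraMap ℂ _ (t * f v)
          + ∑ s : Refl G, (c s * f (v - natRep G s.1 v)) • FreeAlgebra.ι ℂ (.grp s.1))

/-- The rational Cherednik algebra `H_{t,c}(G)`. -/
abbrev RatCher [Finite G] (t : ℂ) (c : Refl G → ℂ) := RingQuot (CherRel t c)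

namespace RatCher

variable [Finite G] (t : ℂ) (c : Refl G → ℂ)

/-- The linear map `V → H_{t,c}(G)`. -/
def vec : V →ₗ[ℂ] RatCher t c where
  toFun v := RingQuot.mkAlgHom ℂ (CherRel t c) (FreeAlgebra.ι ℂ (.vec v))
  map_add' v w := by rw [RingQuot.mkAlgHom_rel ℂ (CherRel.vec_add v w), map_add]
  map_smul' z v := by
    rw [RingQuot.mkAlgHom_rel ℂ (CherRel.vec_smul z v), map_smul, RingHom.id_apply]

/-- The linear map `V* → H_{t,c}(G)`. -/
def cov : Module.Dual ℂ V →ₗ[ℂ] RatCher t c where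
  toFun f := RingQuot.mkAlgHom ℂ (CherRel t c) (FreeAlgebra.ι ℂ (.cov f))
  map_add' f f' := by rw [RingQuot.mkAlgHom_rel ℂ (CherRel.cov_add f f'), map_add]
  map_smul' z f := by
    rw [RingQuot.mkAlgHom_rel ℂ (CherRel.cov_smul z f), map_smul, RingHom.id_apply]

/-- The group elements in `H_{t,c}(G)`. -/
def grp (g : G) : RatCher t c := RingQuot.mkAlgHom ℂ (CherRel t c) (FreeAlgebra.ι ℂ (.grp g))

end RatCher

/-- The relations imposed on `H_{0,c}(G)` to obtain the restricted Cherednik algebra: elements of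
`S(V)^G_+` and of `S(V*)^G_+` become zero. An element of the symmetric algebra is represented by an
element `x` of the tensor algebra that maps to it; its image in `H_{0,c}(G)`, where vectors commute
with vectors and forms with forms, does not depend on the choice of `x`. -/
inductive RestrRel [Finite G] (c : Refl G → ℂ) : RatCher 0 c → RatCher 0 c → Prop
  | vec (x : TensorAlgebra ℂ V)
      (hx : SymmetricAlgebra.algHom ℂ V x ∈ posInvariants (natRep G)) :
      RestrRel c (TensorAlgebra.lift ℂ (RatCher.vec 0 c) x) 0
  | cov (x : TensorAlgebra ℂ (Module.Dual ℂ V))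
      (hx : SymmetricAlgebra.algHom ℂ (Module.Dual ℂ V) x ∈ posInvariants (natRep G).dual) :
      RestrRel c (TensorAlgebra.lift ℂ (RatCher.cov 0 c) x) 0

/-- The restricted Cherednik algebra `H_{0,c}(G) / ⟨S(V)^G_+, S(V*)^G_+⟩`. -/
abbrev RestrCher [Finite G] (c : Refl G → ℂ) := RingQuot (RestrRel c)

namespace RestrCher

variable [Finite G] (c : Refl G → ℂ)

/-- The image of a vector in the restricted Cherednik algebra. -/
def vec (v : V) : RestrCher c := RingQuot.mkAlgHom ℂ (RestrRel c) (RatCher.vec 0 c v)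

/-- The image of a linear form in the restricted Cherednik algebra. -/
def cov (f : Module.Dual ℂ V) : RestrCher c :=
  RingQuot.mkAlgHom ℂ (RestrRel c) (RatCher.cov 0 c f)

/-- The image of a group element in the restricted Cherednik algebra. -/
def grp (g : G) : RestrCher c := RingQuot.mkAlgHom ℂ (RestrRel c) (RatCher.grp 0 c g)

end RestrCher

end Cherednik

end

open Cherednik

/-! Two analogues of partial derivatives agree up to scalars: the divided differences
`p ↦ (p - s(p)) / α̌_s` on `S(V)` and the braided derivatives in the directions `[s]` on `B(Y_G)`:
the map `v ↦ ∑ c_s ⟨α_s, v⟩ [s]` intertwines `c_s` times the former with the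
latter. Divided differences kill invariants, and an element of `B(Y_G)` with zero constant term
and zero braided derivatives vanishes; so the ideal generated by the positive invariants goes to
zero. Conversely the kernel of `S(V) → B(Y_G)` is stable under the divided differences with
`c_s ≠ 0`. If these `s` generate `G`, then by induction on the degree each `p` in the kernel is
invariant modulo that ideal, and averaging over `G` puts `p` into it.

For `S(V*)` the same argument applies with twisted commutators with the `[s]` in place of the
braided derivatives. The Heisenberg double acts on `B(Y_G)`, each `[s]` by left multiplication and
each `[s]*` by a braided derivative; keeping track of the degree in `G` gives a representation in
`End B(Y_G) ⊗ ℂG`. There the braided commutators with right multiplication by `[s]` annihilate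
`B(Y_G)` and `G` and differentiate the `[s]*`. They therefore separate the factors of
`S(V)_G ⊗ ℂG ⊗ S(V*)_G`, which spans the restricted Cherednik algebra.
-/

noncomputable section

namespace Cherednik

open scoped Matrix

/-! ### Skew derivations -/

section SkewDerivation

variable {K A : Type*} [CommRing K] [Ring A] [Algebra K A]

/-- `D` is a skew derivation of the algebra `A` twisted by `θ` on the right: it satisfies the
Leibniz rule `D (p q) = p D(q) + D(p) θ(q)`. -/
def IsSkewDerivation (θ : A →ₐ[K] A) (D : A →ₗ[K] A) : Prop :=
  ∀ p q, D (p * q) = p * D q + D p * θ q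

namespace IsSkewDerivation

variable {θ : A →ₐ[K] A} {D : A →ₗ[K] A}

theorem map_one (h : IsSkewDerivation θ D) : D 1 = 0 := by
  simpa using h 1 1

theorem map_mem_pow (h : IsSkewDerivation θ D) {W : Submodule K A}
    (hD : ∀ p ∈ W, D p ∈ (1 : Submodule K A)) (hθ : ∀ p ∈ W, θ p ∈ W) {n : ℕ} {p : A}
    (hp : p ∈ W ^ (n + 1)) : D p ∈ W ^ n := by
  induction n generalizing p with
  | zero =>
    rw [zero_add, pow_one] at hp
    rw [pow_zero]
    exact hD p hp
  | succ n ih =>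
    rw [pow_succ] at hp
    induction hp using Submodule.mul_induction_on' with
    | mem_mul_mem p hp q hq =>
      rw [h]
      refine add_mem ?_ ?_
      · simpa only [mul_one] using Submodule.mul_mem_mul hp (hD q hq)
      · rw [pow_succ]
        exact Submodule.mul_mem_mul (ih hp) (hθ q hq)
    | add p _ q _ hp hq => rw [map_add]; exact add_mem hp hq

end IsSkewDerivation

/-- The upper right entry of a homomorphism into matrices; for upper triangular values with
diagonal `(p, θ p)` it is a skew derivation. -/
def upperRight (Φ : A →ₐ[K] Matrix (Fin 2) (Fin 2) A) : A →ₗ[K] A :=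
  Matrix.entryLinearMap K A 0 1 ∘ₗ Φ.toLinearMap

theorem upperRight_apply_of_eq {Φ : A →ₐ[K] Matrix (Fin 2) (Fin 2) A} {u a b d : A}
    (h : Φ u = !![a, d; 0, b]) : upperRight Φ u = d := by
  simp [upperRight, h]

section

variable {Φ : A →ₐ[K] Matrix (Fin 2) (Fin 2) A} {θ : A →ₐ[K] A} {s : Set A}
  (hs : Algebra.adjoin K s = ⊤) {d : A → A} (h : ∀ u ∈ s, Φ u = !![u, d u; 0, θ u])
include hs h

theorem eq_triangular_upperRight (p : A) : Φ p = !![p, upperRight Φ p; 0, θ p] := by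
  have hp : p ∈ Algebra.adjoin K s := hs ▸ Algebra.mem_top
  suffices Φ p 0 0 = p ∧ Φ p 1 0 = 0 ∧ Φ p 1 1 = θ p by
    ext i j
    fin_cases i <;> fin_cases j <;> simp [upperRight, this]
  induction hp using Algebra.adjoin_induction with
  | mem u hu => simp [h u hu]
  | algebraMap z => simp [Matrix.algebraMap_matrix_apply]
  | add p q _ _ hp hq => simp [hp, hq]
  | mul p q _ _ hp hq => simp [Matrix.mul_apply, hp, hq]

theorem isSkewDerivation_upperRight : IsSkewDerivation θ (upperRight Φ) := fun p q =>
  upperRight_apply_of_eq (a := p * q) (b := θ p * θ q) <| by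
    rw [map_mul, eq_triangular_upperRight hs h p, eq_triangular_upperRight hs h q,
      Matrix.mul_fin_two]
    simp

end

end SkewDerivation

/-! ### Divided differences on symmetric algebras -/

section Symmetric

variable {K U : Type*} [CommRing K] [AddCommGroup U] [Module K U]

/-- The extension of a linear map with commuting values in a possibly noncommutative algebra to the
symmetric algebra. -/
def symLift {A : Type*} [Semiring A] [Algebra K A] (f : U →ₗ[K] A)
    (hf : ∀ u v, Commute (f u) (f v)) : SymmetricAlgebra K U →ₐ[K] A :=
  RingCon.liftₐ (TensorAlgebra.symRingCon K U) (TensorAlgebra.lift K f)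
    (RingCon.ringConGen_le.2 fun x y h => by
      induction h with
      | mul_comm x y => simp [RingCon.ker_apply, (hf x y).eq])

section

variable {A : Type*} [Semiring A] [Algebra K A]

theorem symLift_algHom (f : U →ₗ[K] A) (hf : ∀ u v, Commute (f u) (f v)) (x : TensorAlgebra K U) :
    symLift f hf (SymmetricAlgebra.algHom K U x) = TensorAlgebra.lift K f x :=
  rfl

@[simp]
theorem symLift_ι (f : U →ₗ[K] A) (hf : ∀ u v, Commute (f u) (f v)) (u : U) :
    symLift f hf (SymmetricAlgebra.ι K U u) = f u :=
  (symLift_algHom f hf _).trans (TensorAlgebra.lift_ι_apply f u)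

end

theorem adjoin_range_symmetricAlgebra_ι :
    Algebra.adjoin K (Set.range (SymmetricAlgebra.ι K U)) = ⊤ := by
  refine top_unique fun p _ => ?_
  induction p using SymmetricAlgebra.induction with
  | algebraMap r => exact Subalgebra.algebraMap_mem _ r
  | ι u => exact Algebra.subset_adjoin ⟨u, rfl⟩
  | mul p q hp hq => exact mul_mem (hp trivial) (hq trivial)
  | add p q hp hq => exact add_mem (hp trivial) (hq trivial)

variable (f : Module.Dual K U) (a : U)

/-- The transvection-like endomorphism `u ↦ u - f(u) a`, which is a reflection when it has finite
order; extended to the symmetric algebra. -/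
def symReflect : SymmetricAlgebra K U →ₐ[K] SymmetricAlgebra K U :=
  SymmetricAlgebra.lift (SymmetricAlgebra.ι K U ∘ₗ (LinearMap.id - f.smulRight a))

@[simp]
theorem symReflect_ι (u : U) :
    symReflect f a (SymmetricAlgebra.ι K U u) = SymmetricAlgebra.ι K U (u - f u • a) := by
  simp [symReflect]

/-- The homomorphism of the symmetric algebra into upper triangular matrices whose upper right
entry is the divided difference. -/
def dividedDiffMatrix :
    SymmetricAlgebra K U →ₐ[K] Matrix (Fin 2) (Fin 2) (SymmetricAlgebra K U) :=
  symLift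
    { toFun u := !![SymmetricAlgebra.ι K U u, algebraMap K _ (f u);
        0, SymmetricAlgebra.ι K U (u - f u • a)]
      map_add' u v := by
        ext i j; fin_cases i <;> fin_cases j <;> simp [add_smul, add_sub_add_comm]
      map_smul' z u := by
        ext i j
        fin_cases i <;> fin_cases j <;> simp [smul_sub, mul_smul, Algebra.algebraMap_eq_smul_one] }
    fun u v => by
      ext i j
      fin_cases i <;> fin_cases j <;> simp [Matrix.mul_apply, Algebra.smul_def] <;> ring

/-- The divided difference operator `p ↦ (p - θ p) / a` on the symmetric algebra, where `θ` extends
`u ↦ u - f(u) a`. -/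
def dividedDiff : SymmetricAlgebra K U →ₗ[K] SymmetricAlgebra K U :=
  upperRight (dividedDiffMatrix f a)

theorem dividedDiffMatrix_ι (u : U) :
    dividedDiffMatrix f a (SymmetricAlgebra.ι K U u) =
      !![SymmetricAlgebra.ι K U u, algebraMap K _ (f u);
        0, symReflect f a (SymmetricAlgebra.ι K U u)] := by
  simp [dividedDiffMatrix]

@[simp]
theorem dividedDiff_ι (u : U) :
    dividedDiff f a (SymmetricAlgebra.ι K U u) = algebraMap K _ (f u) :=
  upperRight_apply_of_eq (dividedDiffMatrix_ι f a u)

theorem isSkewDerivation_dividedDiff : IsSkewDerivation (symReflect f a) (dividedDiff f a) :=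
  isSkewDerivation_upperRight adjoin_range_symmetricAlgebra_ι
    (d := dividedDiff f a) fun _ ⟨u, hu⟩ => by rw [← hu, dividedDiff_ι, dividedDiffMatrix_ι]

theorem ι_mul_dividedDiff (p : SymmetricAlgebra K U) :
    SymmetricAlgebra.ι K U a * dividedDiff f a p = p - symReflect f a p := by
  induction p using SymmetricAlgebra.induction with
  | algebraMap r =>
    rw [AlgHom.commutes, sub_self, Algebra.algebraMap_eq_smul_one, map_smul,
      (isSkewDerivation_dividedDiff f a).map_one, smul_zero, mul_zero]
  | ι u => simp [Algebra.smul_def, mul_comm]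
  | mul p q hp hq =>
    rw [isSkewDerivation_dividedDiff f a, map_mul]
    linear_combination p * hq + symReflect f a q * hp
  | add p q hp hq => rw [map_add, map_add, mul_add, hp, hq]; ring

theorem exists_mem_pow_one_sup_range_ι (p : SymmetricAlgebra K U) :
    ∃ n, p ∈ (1 ⊔ LinearMap.range (SymmetricAlgebra.ι K U)) ^ n := by
  induction p using SymmetricAlgebra.induction with
  | algebraMap r => exact ⟨0, by simp [Submodule.mem_one]⟩
  | ι u => exact ⟨1, by rw [pow_one]; exact Submodule.mem_sup_right ⟨u, rfl⟩⟩
  | mul p q hp hq =>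
    obtain ⟨m, hm⟩ := hp
    obtain ⟨n, hn⟩ := hq
    exact ⟨m + n, pow_add (1 ⊔ LinearMap.range (SymmetricAlgebra.ι K U)) m n ▸
      Submodule.mul_mem_mul hm hn⟩
  | add p q hp hq =>
    obtain ⟨m, hm⟩ := hp
    obtain ⟨n, hn⟩ := hq
    have hW : 1 ≤ 1 ⊔ LinearMap.range (SymmetricAlgebra.ι K U) := le_sup_left
    exact ⟨max m n, add_mem (pow_le_pow_right₀ hW (le_max_left m n) hm)
      (pow_le_pow_right₀ hW (le_max_right m n) hn)⟩

theorem dividedDiff_mem_pow {n : ℕ} {p : SymmetricAlgebra K U}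
    (hp : p ∈ (1 ⊔ LinearMap.range (SymmetricAlgebra.ι K U)) ^ (n + 1)) :
    dividedDiff f a p ∈ (1 ⊔ LinearMap.range (SymmetricAlgebra.ι K U)) ^ n := by
  refine (isSkewDerivation_dividedDiff f a).map_mem_pow (fun q hq => ?_) (fun q hq => ?_) hp <;>
    obtain ⟨_, hz, _, ⟨u, rfl⟩, rfl⟩ := Submodule.mem_sup.1 hq <;>
    obtain ⟨z, rfl⟩ := Submodule.mem_one.1 hz
  · rw [map_add, dividedDiff_ι, Algebra.algebraMap_eq_smul_one z, map_smul,
      (isSkewDerivation_dividedDiff f a).map_one, smul_zero, zero_add]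
    exact Submodule.mem_one.2 ⟨f u, rfl⟩
  · rw [map_add, AlgHom.commutes, symReflect_ι]
    exact add_mem (Submodule.mem_sup_left hz) (Submodule.mem_sup_right ⟨_, rfl⟩)

end Symmetric

/-! ### Coinvariant algebras and divided differences -/

section Coinvariants

variable {Γ U : Type*} [Group Γ] [AddCommGroup U] [Module ℂ U] (ρ : Representation ℂ Γ U)

@[simp]
theorem symAct_ι (g : Γ) (u : U) :
    symAct ρ g (SymmetricAlgebra.ι ℂ U u) = SymmetricAlgebra.ι ℂ U (ρ g u) := by
  simp [symAct]

theorem symAct_mul (g h : Γ) (p : SymmetricAlgebra ℂ U) :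
    symAct ρ (g * h) p = symAct ρ g (symAct ρ h p) := by
  have : symAct ρ (g * h) = (symAct ρ g).comp (symAct ρ h) :=
    SymmetricAlgebra.algHom_ext (by ext u; simp)
  exact DFunLike.congr_fun this p

theorem symAct_one (p : SymmetricAlgebra ℂ U) : symAct ρ 1 p = p := by
  have : symAct ρ 1 = AlgHom.id ℂ _ := SymmetricAlgebra.algHom_ext (by ext u; simp)
  exact DFunLike.congr_fun this p

theorem algebraMapInv_symAct (g : Γ) (p : SymmetricAlgebra ℂ U) :
    SymmetricAlgebra.algebraMapInv (symAct ρ g p) = SymmetricAlgebra.algebraMapInv p := by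
  have : (SymmetricAlgebra.algebraMapInv).comp (symAct ρ g) = SymmetricAlgebra.algebraMapInv :=
    SymmetricAlgebra.algHom_ext (by ext u; simp [SymmetricAlgebra.algebraMapInv_ι])
  exact DFunLike.congr_fun this p

theorem symAct_mem_span_posInvariants (g : Γ) {p : SymmetricAlgebra ℂ U}
    (hp : p ∈ Ideal.span (posInvariants ρ)) : symAct ρ g p ∈ Ideal.span (posInvariants ρ) := by
  induction hp using Submodule.span_induction with
  | mem p h => rw [h.1 g]; exact Ideal.subset_span h
  | zero => simp
  | add p q _ _ hp hq => rw [map_add]; exact add_mem hp hq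
  | smul r p _ hp => rw [smul_eq_mul, map_mul]; exact Ideal.mul_mem_left _ _ hp

theorem sum_symAct_mem_posInvariants [Fintype Γ] {p : SymmetricAlgebra ℂ U}
    (hp : SymmetricAlgebra.algebraMapInv p = 0) : ∑ g, symAct ρ g p ∈ posInvariants ρ := by
  refine ⟨fun g => ?_, ?_⟩
  · rw [map_sum]
    simp_rw [← symAct_mul]
    exact Fintype.sum_equiv (Equiv.mulLeft g) _ _ fun _ => rfl
  · rw [map_sum]
    exact Finset.sum_eq_zero fun g _ => by rw [algebraMapInv_symAct, hp]

theorem mem_span_posInvariants_of_sub_symAct_mem [Finite Γ] {p : SymmetricAlgebra ℂ U}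
    (h0 : SymmetricAlgebra.algebraMapInv p = 0)
    (h : ∀ g, p - symAct ρ g p ∈ Ideal.span (posInvariants ρ)) :
    p ∈ Ideal.span (posInvariants ρ) := by
  have := Fintype.ofFinite Γ
  have hcard : (Fintype.card Γ : ℂ) ≠ 0 := Nat.cast_ne_zero.2 Fintype.card_ne_zero
  have hsum : (Fintype.card Γ : ℂ) • p = ∑ g, (p - symAct ρ g p) + ∑ g, symAct ρ g p := by
    rw [Finset.sum_sub_distrib, sub_add_cancel, Finset.sum_const, Finset.card_univ,
      Nat.cast_smul_eq_nsmul]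
  rw [← inv_smul_smul₀ hcard p, hsum, Algebra.smul_def]
  exact Ideal.mul_mem_left _ _ (add_mem (sum_mem fun g _ => h g)
    (Ideal.subset_span (sum_symAct_mem_posInvariants ρ h0)))

theorem sub_symAct_mem_of_closure {I : Ideal (SymmetricAlgebra ℂ U)}
    (hI : ∀ g, ∀ q ∈ I, symAct ρ g q ∈ I) {s : Set Γ} {p : SymmetricAlgebra ℂ U}
    (h : ∀ g ∈ s, p - symAct ρ g p ∈ I) {g : Γ} (hg : g ∈ Subgroup.closure s) :
    p - symAct ρ g p ∈ I := by
  induction hg using Subgroup.closure_induction with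
  | mem g hg => exact h g hg
  | one => simp [symAct_one]
  | mul g g' _ _ hg hg' =>
    have hsplit : p - symAct ρ (g * g') p
        = (p - symAct ρ g p) + symAct ρ g (p - symAct ρ g' p) := by
      rw [map_sub, symAct_mul]; ring
    rw [hsplit]
    exact add_mem hg (hI g _ hg')
  | inv g _ hg =>
    have hinv : p - symAct ρ g⁻¹ p = -symAct ρ g⁻¹ (p - symAct ρ g p) := by
      rw [map_sub, ← symAct_mul, inv_mul_cancel, symAct_one]; ring
    rw [hinv]
    exact neg_mem (hI _ _ hg)

theorem symmetricAlgebra_ι_ne_zero {u : U} (hu : u ≠ 0) : SymmetricAlgebra.ι ℂ U u ≠ 0 := by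
  obtain ⟨f, hf⟩ : ∃ f : Module.Dual ℂ U, f u ≠ 0 := by
    by_contra! h
    exact hu ((Module.forall_dual_apply_eq_zero_iff ℂ u).1 h)
  intro h
  exact hf (by rw [← SymmetricAlgebra.lift_ι_apply f u, h, map_zero])

/-- A family of elements of `Γ` acting on `U` by reflections `u ↦ u - ⟨α_s, u⟩ α̌_s`. It is used
both for the tautological representation of a reflection group and for its dual. -/
structure ReflectionFamily (S : Type*) where
  elt : S → Γ
  root : S → Module.Dual ℂ U
  coroot : S → U
  apply_eq : ∀ s u, ρ (elt s) u = u - root s u • coroot s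
  coroot_ne_zero : ∀ s, coroot s ≠ 0

variable {ρ} {S : Type*}

namespace ReflectionFamily

variable (T : ReflectionFamily ρ S)

/-- The divided difference operator `p ↦ (p - s(p)) / α̌_s`. -/
abbrev diff (s : S) : SymmetricAlgebra ℂ U →ₗ[ℂ] SymmetricAlgebra ℂ U :=
  dividedDiff (T.root s) (T.coroot s)

theorem symAct_elt (s : S) : symAct ρ (T.elt s) = symReflect (T.root s) (T.coroot s) :=
  SymmetricAlgebra.algHom_ext (by ext u; simp [T.apply_eq])

theorem ι_mul_diff (s : S) (p : SymmetricAlgebra ℂ U) :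
    SymmetricAlgebra.ι ℂ U (T.coroot s) * T.diff s p = p - symAct ρ (T.elt s) p := by
  rw [ι_mul_dividedDiff, symAct_elt]

theorem diff_eq_zero {p : SymmetricAlgebra ℂ U} (hp : p ∈ posInvariants ρ) (s : S) :
    T.diff s p = 0 := by
  have h := T.ι_mul_diff s p
  rw [hp.1, sub_self] at h
  exact (mul_eq_zero.1 h).resolve_left (symmetricAlgebra_ι_ne_zero (T.coroot_ne_zero s))

theorem mem_span_posInvariants_of_stable [Finite Γ] {A : Set S}
    (hA : Subgroup.closure (T.elt '' A) = ⊤) {P : Submodule ℂ (SymmetricAlgebra ℂ U)}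
    (h0 : ∀ p ∈ P, SymmetricAlgebra.algebraMapInv p = 0)
    (hP : ∀ s ∈ A, ∀ p ∈ P, T.diff s p ∈ P) {p : SymmetricAlgebra ℂ U} (hp : p ∈ P) :
    p ∈ Ideal.span (posInvariants ρ) := by
  obtain ⟨n, hn⟩ := exists_mem_pow_one_sup_range_ι p
  induction n generalizing p with
  | zero =>
    rw [pow_zero] at hn
    obtain ⟨z, rfl⟩ := Submodule.mem_one.1 hn
    have hz : z = 0 := by
      simpa only [AlgHom.commutes, Algebra.algebraMap_self, RingHom.id_apply] using h0 _ hp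
    rw [hz, map_zero]
    exact zero_mem _
  | succ n ih =>
    refine mem_span_posInvariants_of_sub_symAct_mem ρ (h0 p hp) fun g => ?_
    refine sub_symAct_mem_of_closure ρ (fun g _ => symAct_mem_span_posInvariants ρ g)
      (s := T.elt '' A) ?_ (hA ▸ Subgroup.mem_top g)
    rintro _ ⟨s, hs, rfl⟩
    rw [← T.ι_mul_diff]
    exact Ideal.mul_mem_left _ _ (ih (hP s hs p hp) (dividedDiff_mem_pow _ _ hn))

end ReflectionFamily

/-- An algebra `B` with skew derivations `D_s`, twisted by `θ_s`, that are jointly injective up to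
an augmentation `ε`, and a linear map `val : U → B` on which they act as multiples `c_s` of the
divided differences. The augmentation may take values in any vector space. -/
structure DividedDiffRealization (T : ReflectionFamily ρ S) (c : S → ℂ) (B E : Type*) [Ring B]
    [Algebra ℂ B] [AddCommGroup E] [Module ℂ E] where
  θ : S → B →ₐ[ℂ] B
  D : S → B →ₗ[ℂ] B
  ε : B →ₗ[ℂ] E
  val : U →ₗ[ℂ] B
  isSkewDerivation : ∀ s, IsSkewDerivation (θ s) (D s)
  D_val : ∀ s u, D s (val u) = algebraMap ℂ B (c s * T.root s u)
  θ_val : ∀ s u, θ s (val u) = val (ρ (T.elt s) u)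
  ε_one : ε 1 ≠ 0
  ε_mul_val : ∀ p u, ε (p * val u) = 0
  eq_zero : ∀ p, ε p = 0 → (∀ s, D s p = 0) → p = 0

namespace DividedDiffRealization

variable {T : ReflectionFamily ρ S} {c : S → ℂ} {B E : Type*} [Ring B] [Algebra ℂ B]
  [AddCommGroup E] [Module ℂ E] (R : DividedDiffRealization T c B E)

theorem commute_val (u v : U) : Commute (R.val u) (R.val v) := by
  refine sub_eq_zero.1 (R.eq_zero _ ?_ fun s => ?_)
  · rw [map_sub, R.ε_mul_val, R.ε_mul_val, sub_zero]
  · rw [map_sub, R.isSkewDerivation, R.isSkewDerivation]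
    simp only [R.D_val, R.θ_val, T.apply_eq, map_sub, map_smul, ← Algebra.commutes,
      ← Algebra.smul_def, smul_sub, smul_smul]
    rw [show c s * T.root s u * T.root s v = c s * T.root s v * T.root s u by ring]
    abel

/-- The extension of `U → B` to the symmetric algebra. -/
def toHom : SymmetricAlgebra ℂ U →ₐ[ℂ] B := symLift R.val R.commute_val

@[simp]
theorem toHom_ι (u : U) : R.toHom (SymmetricAlgebra.ι ℂ U u) = R.val u :=
  symLift_ι _ _ u

theorem θ_toHom (s : S) (p : SymmetricAlgebra ℂ U) :
    R.θ s (R.toHom p) = R.toHom (symAct ρ (T.elt s) p) := by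
  induction p using SymmetricAlgebra.induction with
  | algebraMap z => simp only [AlgHom.commutes]
  | ι u => rw [toHom_ι, R.θ_val, symAct_ι, toHom_ι]
  | mul p q hp hq => rw [map_mul, map_mul, hp, hq, map_mul, map_mul]
  | add p q hp hq => rw [map_add, map_add, hp, hq, map_add, map_add]

theorem D_toHom (s : S) (p : SymmetricAlgebra ℂ U) :
    R.D s (R.toHom p) = c s • R.toHom (T.diff s p) := by
  induction p using SymmetricAlgebra.induction with
  | algebraMap z =>
    simp only [Algebra.algebraMap_eq_smul_one, map_smul, map_one, (R.isSkewDerivation s).map_one,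
      (isSkewDerivation_dividedDiff (T.root s) (T.coroot s)).map_one, smul_zero, map_zero]
  | ι u => rw [toHom_ι, R.D_val, dividedDiff_ι, AlgHom.commutes, map_mul, ← Algebra.smul_def]
  | mul p q hp hq =>
    rw [map_mul, R.isSkewDerivation, hp, hq, θ_toHom, isSkewDerivation_dividedDiff, map_add,
      map_mul, map_mul, T.symAct_elt, mul_smul_comm, smul_mul_assoc, smul_add]
  | add p q hp hq => simp only [map_add, hp, hq, smul_add]

theorem ε_mul_toHom (b : B) (p : SymmetricAlgebra ℂ U) :
    R.ε (b * R.toHom p) = SymmetricAlgebra.algebraMapInv p • R.ε b := by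
  induction p using SymmetricAlgebra.induction generalizing b with
  | algebraMap z =>
    rw [AlgHom.commutes, AlgHom.commutes, ← Algebra.commutes, ← Algebra.smul_def, map_smul]
    rfl
  | ι u => rw [toHom_ι, R.ε_mul_val, SymmetricAlgebra.algebraMapInv_ι, zero_smul]
  | mul p q hp hq => rw [map_mul R.toHom, ← mul_assoc, hq, hp, map_mul, smul_smul, mul_comm]
  | add p q hp hq => rw [map_add, mul_add, map_add, hp, hq, map_add, add_smul]

theorem algebraMapInv_smul_ε_one (p : SymmetricAlgebra ℂ U) :
    SymmetricAlgebra.algebraMapInv p • R.ε 1 = R.ε (R.toHom p) := by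
  rw [← R.ε_mul_toHom, one_mul]

theorem toHom_eq_zero_of_mem {p : SymmetricAlgebra ℂ U} (hp : p ∈ Ideal.span (posInvariants ρ)) :
    R.toHom p = 0 := by
  have hle : Ideal.span (posInvariants ρ) ≤ RingHom.ker R.toHom :=
    Ideal.span_le.2 fun q hq => R.eq_zero _
      (by rw [← R.algebraMapInv_smul_ε_one, hq.2, zero_smul])
      fun s => by rw [R.D_toHom, T.diff_eq_zero hq, map_zero, smul_zero]
  exact hle hp

theorem mem_of_toHom_eq_zero [Finite Γ]
    (hc : Subgroup.closure (T.elt '' {s | c s ≠ 0}) = ⊤) {p : SymmetricAlgebra ℂ U}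
    (hp : R.toHom p = 0) : p ∈ Ideal.span (posInvariants ρ) := by
  refine T.mem_span_posInvariants_of_stable hc (P := LinearMap.ker R.toHom.toLinearMap)
    (fun q hq => ?_) (fun s hs q hq => ?_) hp
  · refine (smul_eq_zero.1 ?_).resolve_right R.ε_one
    rw [R.algebraMapInv_smul_ε_one, show R.toHom q = 0 from hq, map_zero]
  · refine (smul_eq_zero.1 ?_).resolve_left hs
    rw [AlgHom.toLinearMap_apply, ← R.D_toHom, show R.toHom q = 0 from hq, map_zero]

/-- The homomorphism from the coinvariant algebra that extends `U → B`. -/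
def coinvariantHom : Coinvariant ρ →ₐ[ℂ] B :=
  Ideal.Quotient.liftₐ _ R.toHom fun _ => R.toHom_eq_zero_of_mem

theorem coinvariantHom_injective [Finite Γ]
    (hc : Subgroup.closure (T.elt '' {s | c s ≠ 0}) = ⊤) : Function.Injective R.coinvariantHom := by
  refine (injective_iff_map_eq_zero _).2 fun q hq => ?_
  obtain ⟨p, rfl⟩ := Ideal.Quotient.mk_surjective q
  exact Ideal.Quotient.eq_zero_iff_mem.2 (R.mem_of_toHom_eq_zero hc hq)

end DividedDiffRealization

end Coinvariants

/-! ### Tensor powers and braided factorials -/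

section TensorPowers

variable {ι : Type*}

/-- The word `u` followed by the letter `r`. -/
abbrev snoc {n : ℕ} (u : Fin n → ι) (r : ι) : Fin (n + 1) → ι := Fin.snoc (α := fun _ => ι) u r

theorem exists_eq_snoc {n : ℕ} (w : Fin (n + 1) → ι) : ∃ u r, w = snoc u r :=
  ⟨_, _, (Fin.snoc_init_self w).symm⟩

theorem sum_snoc [Fintype ι] {M : Type*} [AddCommMonoid M] {n : ℕ} (f : (Fin (n + 1) → ι) → M) :
    ∑ w, f w = ∑ r, ∑ u, f (snoc u r) := by
  rw [← (Fin.snocEquiv fun _ : Fin (n + 1) => ι).sum_comp, Fintype.sum_prod_type]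
  rfl

/-- The coefficients of the words that end in the letter `r`. -/
def slice {n : ℕ} (a : (Fin (n + 1) → ι) → ℂ) (r : ι) : (Fin n → ι) → ℂ := fun u => a (snoc u r)

theorem slice_ext {n : ℕ} {a b : (Fin (n + 1) → ι) → ℂ} (h : ∀ r, slice a r = slice b r) :
    a = b := by
  funext w
  obtain ⟨u, r, rfl⟩ := exists_eq_snoc w
  exact congrFun (h r) u

@[simp]
theorem slice_add {n : ℕ} (a b : (Fin (n + 1) → ι) → ℂ) (r : ι) :
    slice (a + b) r = slice a r + slice b r :=
  rfl

theorem slice_sum_smul {κ : Type*} {n : ℕ} (t : Finset κ) (z : κ → ℂ)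
    (b : κ → (Fin (n + 1) → ι) → ℂ) (r : ι) :
    slice (∑ k ∈ t, z k • b k) r = ∑ k ∈ t, z k • slice (b k) r := by
  funext u
  simp [slice, Finset.sum_apply]

variable [DecidableEq ι]

/-- The operator `A ⊗ id`. -/
def extendRight [Fintype ι] {n : ℕ} : Matrix (Fin n → ι) (Fin n → ι) ℂ →+*
    Matrix (Fin (n + 1) → ι) (Fin (n + 1) → ι) ℂ where
  toFun A := Matrix.of fun u w =>
    if u (Fin.last n) = w (Fin.last n) then A (Fin.init u) (Fin.init w) else 0
  map_one' := by
    ext u w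
    obtain ⟨u, r, rfl⟩ := exists_eq_snoc u
    obtain ⟨w, s, rfl⟩ := exists_eq_snoc w
    simp only [Matrix.of_apply, Fin.snoc_last, Fin.init_snoc, Matrix.one_apply, Fin.snoc_inj]
    split_ifs <;> simp_all
  map_mul' A B := by
    ext u w
    simp only [Matrix.of_apply, Matrix.mul_apply, sum_snoc, Fin.snoc_last, Fin.init_snoc, ite_mul,
      zero_mul]
    rw [Finset.sum_eq_single (u (Fin.last n)) (by intro r _ hr; simp [hr.symm]) (by simp)]
    split_ifs <;> simp_all
  map_zero' := by ext; simp
  map_add' A B := by ext u w; simp only [Matrix.of_apply, Matrix.add_apply]; split_ifs <;> simp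

section

variable [Fintype ι]

theorem extendRight_snoc {n : ℕ} (A : Matrix (Fin n → ι) (Fin n → ι) ℂ) (u w : Fin n → ι)
    (r s : ι) : extendRight A (snoc u r) (snoc w s) = if r = s then A u w else 0 := by
  simp [extendRight]

@[simp]
theorem slice_extendRight_mulVec {n : ℕ} (A : Matrix (Fin n → ι) (Fin n → ι) ℂ)
    (a : (Fin (n + 1) → ι) → ℂ) (r : ι) : slice (extendRight A *ᵥ a) r = A *ᵥ slice a r := by
  funext u
  simp only [slice, Matrix.mulVec, dotProduct, sum_snoc, extendRight_snoc, ite_mul, zero_mul]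
  rw [Finset.sum_eq_single r (by intro s _ hs; simp [hs.symm]) (by simp)]
  simp

end

variable (Ψ : Matrix (ι × ι) (ι × ι) ℂ)

theorem leg_castSucc_snoc {n : ℕ} (p q : Fin n) (u w : Fin n → ι) (r s : ι) :
    leg Ψ (n + 1) p.castSucc q.castSucc (snoc u r) (snoc w s)
      = if r = s then leg Ψ n p q u w else 0 := by
  simp only [leg, Matrix.of_apply, Fin.forall_fin_succ', Fin.snoc_castSucc, Fin.snoc_last, ne_eq,
    Fin.castSucc_inj, (Fin.castSucc_lt_last _).ne', not_false_eq_true, forall_const]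
  by_cases hrs : r = s <;> simp [hrs]

theorem adjLeg_last {n : ℕ} (u w : Fin n → ι) (k l r s : ι) :
    adjLeg Ψ (n + 2) n (snoc (snoc u k) l) (snoc (snoc w r) s)
      = if u = w then Ψ (k, l) (r, s) else 0 := by
  rw [adjLeg, dif_pos (by omega)]
  have hn : (⟨n, by omega⟩ : Fin (n + 2)) = (Fin.last n).castSucc := rfl
  have hn' : (⟨n + 1, by omega⟩ : Fin (n + 2)) = Fin.last (n + 1) := rfl
  simp only [leg, Matrix.of_apply, hn, hn', Fin.forall_fin_succ', Fin.snoc_castSucc,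
    Fin.snoc_last, funext_iff]
  simp [Fin.castSucc_inj, Fin.castSucc_ne_last]

section

variable [Fintype ι]

theorem adjLeg_succ {n i : ℕ} (h : i + 1 < n) :
    adjLeg Ψ (n + 1) i = extendRight (adjLeg Ψ n i) := by
  rw [adjLeg, adjLeg, dif_pos h, dif_pos (h.trans (Nat.lt_succ_self n))]
  ext u w
  obtain ⟨u, r, rfl⟩ := exists_eq_snoc u
  obtain ⟨w, s, rfl⟩ := exists_eq_snoc w
  rw [extendRight_snoc]
  exact leg_castSucc_snoc Ψ ⟨i, _⟩ ⟨i + 1, h⟩ u w r s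

theorem slice_slice_adjLeg_mulVec {n : ℕ} (a : (Fin (n + 2) → ι) → ℂ) (k l : ι) :
    slice (slice (adjLeg Ψ (n + 2) n *ᵥ a) l) k
      = ∑ r, ∑ s, Ψ (k, l) (r, s) • slice (slice a s) r := by
  funext u
  simp only [slice, Matrix.mulVec, dotProduct, sum_snoc, adjLeg_last, ite_mul, zero_mul,
    Finset.sum_apply, Pi.smul_apply, smul_eq_mul]
  rw [Finset.sum_comm]
  simp

theorem braidedInt_one (n : ℕ) : braidedInt Ψ n 1 = 1 := by simp [braidedInt]

theorem braidedInt_succ (n m : ℕ) :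
    braidedInt Ψ n (m + 2) = 1 + adjLeg Ψ n m * braidedInt Ψ n (m + 1) := by
  rw [braidedInt, Finset.sum_range_succ', add_comm, braidedInt, Finset.mul_sum]
  congr 1
  refine Finset.sum_congr rfl fun k _ => ?_
  rw [List.range_succ_eq_map, List.map_cons, List.prod_cons, List.map_map]
  congr 3
  funext j
  simp only [Function.comp_apply]
  congr 1
  omega

theorem braidedInt_extendRight {n m : ℕ} (h : m ≤ n) :
    braidedInt Ψ (n + 1) m = extendRight (braidedInt Ψ n m) := by
  rw [braidedInt, braidedInt, map_sum]
  refine Finset.sum_congr rfl fun k hk => ?_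
  rw [map_list_prod, List.map_map]
  congr 1
  refine List.map_congr_left fun j hj => ?_
  have hk := Finset.mem_range.1 hk
  have hj := List.mem_range.1 hj
  exact adjLeg_succ Ψ (by omega)

theorem braidedFactorial_succ (n : ℕ) :
    braidedFactorial Ψ (n + 1)
      = extendRight (braidedFactorial Ψ n) * braidedInt Ψ (n + 1) (n + 1) := by
  rw [braidedFactorial, List.range_succ, List.map_append, List.prod_append, braidedFactorial,
    map_list_prod, List.map_map, List.map_singleton, List.prod_singleton]
  congr 2
  exact List.map_congr_left fun k hk =>
    braidedInt_extendRight Ψ (Nat.succ_le_of_lt (List.mem_range.1 hk))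

theorem slice_braidedInt_mulVec {n : ℕ} (a : (Fin (n + 2) → ι) → ℂ) (s : ι) :
    slice (braidedInt Ψ (n + 2) (n + 2) *ᵥ a) s
      = slice a s
        + slice (adjLeg Ψ (n + 2) n *ᵥ extendRight (braidedInt Ψ (n + 1) (n + 1)) *ᵥ a) s := by
  rw [braidedInt_succ, braidedInt_extendRight Ψ le_rfl, Matrix.add_mulVec, Matrix.one_mulVec,
    Matrix.mulVec_mulVec, slice_add]

theorem slice_braidedFactorial_mulVec {n : ℕ} (a : (Fin (n + 1) → ι) → ℂ) (s : ι) :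
    slice (braidedFactorial Ψ (n + 1) *ᵥ a) s
      = braidedFactorial Ψ n *ᵥ slice (braidedInt Ψ (n + 1) (n + 1) *ᵥ a) s := by
  rw [braidedFactorial_succ, ← Matrix.mulVec_mulVec, slice_extendRight_mulVec]

theorem braidedFactorial_mulVec_eq_zero_iff {n : ℕ} (a : (Fin (n + 1) → ι) → ℂ) :
    braidedFactorial Ψ (n + 1) *ᵥ a = 0 ↔
      ∀ s, braidedFactorial Ψ n *ᵥ slice (braidedInt Ψ (n + 1) (n + 1) *ᵥ a) s = 0 := by
  simp only [← slice_braidedFactorial_mulVec]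
  exact ⟨fun h s => by rw [h]; rfl, fun h => slice_ext h⟩

/-! ### Tensor powers of an operator -/

section

variable (A : Matrix ι ι ℂ)

/-- The tensor power of an operator. -/
def tensorPow (n : ℕ) : Matrix (Fin n → ι) (Fin n → ι) ℂ :=
  Matrix.of fun u w => ∏ k, A (u k) (w k)

omit [DecidableEq ι] in
theorem slice_tensorPow_mulVec {n : ℕ} (a : (Fin (n + 1) → ι) → ℂ) (r : ι) :
    slice (tensorPow A (n + 1) *ᵥ a) r = ∑ s, A r s • (tensorPow A n *ᵥ slice a s) := by
  funext u
  simp only [slice, Matrix.mulVec, dotProduct, sum_snoc, tensorPow, Matrix.of_apply,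
    Fin.prod_univ_castSucc, Fin.snoc_castSucc, Fin.snoc_last, Finset.sum_apply, Pi.smul_apply,
    smul_eq_mul, Finset.mul_sum]
  exact Finset.sum_congr rfl fun s _ => Finset.sum_congr rfl fun w _ => by ring

variable {A}

theorem commute_tensorPow_extendRight {n : ℕ} {M : Matrix (Fin n → ι) (Fin n → ι) ℂ}
    (h : Commute (tensorPow A n) M) : Commute (tensorPow A (n + 1)) (extendRight M) := by
  refine Matrix.mulVec_injective (funext fun a => slice_ext fun r => ?_)
  rw [← Matrix.mulVec_mulVec, ← Matrix.mulVec_mulVec]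
  simp only [slice_tensorPow_mulVec, slice_extendRight_mulVec, Matrix.mulVec_sum,
    Matrix.mulVec_smul]
  simp only [Matrix.mulVec_mulVec, h.eq]

open scoped Kronecker

theorem commute_tensorPow_adjLeg_last {Ψ : Matrix (ι × ι) (ι × ι) ℂ} (h : Commute (A ⊗ₖ A) Ψ)
    (n : ℕ) : Commute (tensorPow A (n + 2)) (adjLeg Ψ (n + 2) n) := by
  refine Matrix.mulVec_injective (funext fun a => slice_ext fun l => slice_ext fun k => ?_)
  have hslice (b : (Fin (n + 2) → ι) → ℂ) (k l : ι) :
      slice (slice (tensorPow A (n + 2) *ᵥ b) l) k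
        = ∑ p : ι × ι, (A ⊗ₖ A) (k, l) p • (tensorPow A n *ᵥ slice (slice b p.2) p.1) := by
    simp only [slice_tensorPow_mulVec, slice_sum_smul, Fintype.sum_prod_type,
      Matrix.kroneckerMap_apply, Finset.smul_sum, smul_smul]
    rw [Finset.sum_comm]
    exact Finset.sum_congr rfl fun _ _ => Finset.sum_congr rfl fun _ _ => by rw [mul_comm]
  have hadj (b : (Fin (n + 2) → ι) → ℂ) (k l : ι) :
      slice (slice (adjLeg Ψ (n + 2) n *ᵥ b) l) k
        = ∑ p : ι × ι, Ψ (k, l) p • slice (slice b p.2) p.1 := by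
    rw [slice_slice_adjLeg_mulVec, Fintype.sum_prod_type]
  rw [← Matrix.mulVec_mulVec, ← Matrix.mulVec_mulVec, hslice, hadj]
  simp only [hslice, hadj, Matrix.mulVec_sum, Matrix.mulVec_smul, Finset.smul_sum, smul_smul]
  rw [Finset.sum_comm, Finset.sum_comm (f := fun p q => (Ψ (k, l) p * _) • _)]
  refine Finset.sum_congr rfl fun p _ => ?_
  rw [← Finset.sum_smul, ← Finset.sum_smul]
  exact congrArg (· • _) (congrFun (congrFun h.eq (k, l)) p)

theorem commute_tensorPow_adjLeg {Ψ : Matrix (ι × ι) (ι × ι) ℂ} (h : Commute (A ⊗ₖ A) Ψ)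
    (n i : ℕ) : Commute (tensorPow A n) (adjLeg Ψ n i) := by
  induction n with
  | zero => simp [adjLeg]
  | succ n ih =>
    rcases lt_trichotomy (i + 1) n with hi | rfl | hi
    · rw [adjLeg_succ Ψ hi]
      exact commute_tensorPow_extendRight ih
    · exact commute_tensorPow_adjLeg_last h i
    · rw [adjLeg, dif_neg (by omega)]
      exact Commute.one_right _

theorem commute_tensorPow_braidedFactorial {Ψ : Matrix (ι × ι) (ι × ι) ℂ}
    (h : Commute (A ⊗ₖ A) Ψ) (n : ℕ) : Commute (tensorPow A n) (braidedFactorial Ψ n) := by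
  refine Commute.list_prod_right _ _ fun x hx => ?_
  obtain ⟨m, -, rfl⟩ := List.mem_map.1 hx
  refine Commute.sum_right _ _ _ fun k _ => Commute.list_prod_right _ _ fun y hy => ?_
  obtain ⟨j, -, rfl⟩ := List.mem_map.1 hy
  exact commute_tensorPow_adjLeg h n _

end

end

end TensorPowers

/-! ### Words -/

section Words

variable {ι : Type*} [Fintype ι] {A : Type*} [Ring A] [Algebra ℂ A] (x : ι → A)

theorem wordSum_zero (a : (Fin 0 → ι) → ℂ) : wordSum x a = algebraMap ℂ A (a Fin.elim0) := by
  rw [wordSum, Fintype.sum_unique, Algebra.algebraMap_eq_smul_one]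
  simp only [List.ofFn_zero, List.prod_nil]
  congr 2

theorem wordSum_succ {n : ℕ} (a : (Fin (n + 1) → ι) → ℂ) :
    wordSum x a = ∑ s, wordSum x (slice a s) * x s := by
  simp only [wordSum, sum_snoc, Finset.sum_mul, slice, smul_mul_assoc]
  refine Finset.sum_congr rfl fun r _ => Finset.sum_congr rfl fun u _ => ?_
  rw [List.ofFn_succ']
  simp

/-- The noncommutative polynomial `wordSum x a` as a linear function of its coefficients. -/
def wordSumₗ (n : ℕ) : ((Fin n → ι) → ℂ) →ₗ[ℂ] A where
  toFun := wordSum x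
  map_add' a b := by simp [wordSum, add_smul, Finset.sum_add_distrib]
  map_smul' z a := by simp [wordSum, mul_smul, Finset.smul_sum]

@[simp]
theorem wordSumₗ_apply {n : ℕ} (a : (Fin n → ι) → ℂ) : wordSumₗ x n a = wordSum x a := rfl

theorem map_wordSum {B : Type*} [Ring B] [Algebra ℂ B] (φ : A →ₐ[ℂ] B) {n : ℕ}
    (a : (Fin n → ι) → ℂ) : φ (wordSum x a) = wordSum (fun i => φ (x i)) a := by
  simp only [wordSum, map_sum, map_smul, map_list_prod, List.map_ofFn]
  rfl

theorem wordSum_tensorPow (M : Matrix ι ι ℂ) {n : ℕ} (a : (Fin n → ι) → ℂ) :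
    wordSum x (tensorPow M n *ᵥ a) = wordSum (fun s => ∑ r, M r s • x r) a := by
  induction n with
  | zero =>
    rw [wordSum_zero, wordSum_zero, Matrix.mulVec, dotProduct, Fintype.sum_unique]
    simp only [tensorPow, Matrix.of_apply, Finset.univ_eq_empty, Finset.prod_empty, one_mul]
    congr 2
  | succ n ih =>
    simp only [wordSum_succ _ (n := n), slice_tensorPow_mulVec, ← ih, ← wordSumₗ_apply, map_sum,
      map_smul, Finset.sum_mul, Finset.mul_sum, smul_mul_assoc, mul_smul_comm]
    exact Finset.sum_comm

theorem wordSum_mul_mem_range {n : ℕ} (a : (Fin n → ι) → ℂ) (j : ι) :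
    wordSum x a * x j ∈ LinearMap.range (wordSumₗ x (n + 1)) := by
  classical
  refine ⟨fun w => if w (Fin.last n) = j then a (Fin.init w) else 0, ?_⟩
  rw [wordSumₗ_apply, wordSum_succ]
  have hslice (s : ι) : slice (fun w => if w (Fin.last n) = j then a (Fin.init w) else 0) s
      = if s = j then a else 0 := by
    funext u
    simp only [slice, Fin.snoc_last, Fin.init_snoc, ite_apply, Pi.zero_apply]
  rw [Fintype.sum_eq_single j fun s hs => by
    rw [hslice, if_neg hs, ← wordSumₗ_apply, map_zero, zero_mul], hslice, if_pos rfl]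

theorem map_wordSum_succ_eq_zero {E : Type*} [AddCommGroup E] [Module ℂ E] {x : ι → A}
    {ε : A →ₗ[ℂ] E} (hεx : ∀ p j, ε (p * x j) = 0) {n : ℕ} (a : (Fin (n + 1) → ι) → ℂ) :
    ε (wordSum x a) = 0 := by
  rw [wordSum_succ, map_sum]
  exact Finset.sum_eq_zero fun s _ => hεx _ _

theorem exists_eq_sum_wordSum {x : ι → A} {p : A} (hp : p ∈ Algebra.adjoin ℂ (Set.range x)) :
    ∃ (N : ℕ) (a : ∀ n, (Fin n → ι) → ℂ), p = ∑ n ∈ Finset.range N, wordSum x (a n) := by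
  have hp' : p ∈ ⨆ n, LinearMap.range (wordSumₗ x n) := by
    have hle : Submodule.span ℂ (Submonoid.closure (Set.range x) : Set A)
        ≤ ⨆ n, LinearMap.range (wordSumₗ x n) := by
      refine Submodule.span_le.2 fun q hq => ?_
      suffices ∃ n, q ∈ LinearMap.range (wordSumₗ x n) from
        let ⟨n, hn⟩ := this
        Submodule.mem_iSup_of_mem n hn
      induction hq using Submonoid.closure_induction_right with
      | one => exact ⟨0, fun _ => 1, by rw [wordSumₗ_apply, wordSum_zero, map_one]⟩
      | mul_right q _ _ hj ih =>
        obtain ⟨n, a, rfl⟩ := ih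
        obtain ⟨j, rfl⟩ := hj
        exact ⟨n + 1, wordSum_mul_mem_range x a j⟩
    rw [← Subalgebra.mem_toSubmodule, Algebra.adjoin_eq_span] at hp
    exact hle hp
  obtain ⟨f, hf, rfl⟩ := (Submodule.mem_iSup_iff_exists_finsupp _ _).1 hp'
  choose a ha using hf
  obtain ⟨N, hN⟩ := f.support.exists_nat_subset_range
  refine ⟨N, a, ?_⟩
  simp only [← wordSumₗ_apply, ha]
  exact Finset.sum_subset hN fun n _ hn => Finsupp.notMem_support_iff.1 hn

theorem exists_forall_eq_sum_wordSum {x : ι → A} {κ : Type*} {t : Finset κ} {p : κ → A}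
    (hp : ∀ k ∈ t, p k ∈ Algebra.adjoin ℂ (Set.range x)) :
    ∃ (N : ℕ) (a : κ → ∀ n, (Fin n → ι) → ℂ),
      ∀ k ∈ t, p k = ∑ n ∈ Finset.range N, wordSum x (a k n) := by
  classical
  choose! N a ha using fun k hk => exists_eq_sum_wordSum (hp k hk)
  refine ⟨t.sup N, fun k n => if n < N k then a k n else 0, fun k hk => (ha k hk).trans ?_⟩
  rw [← Finset.sum_subset (Finset.range_mono (Finset.le_sup hk)) fun n _ hn => by
    simp only [if_neg (Finset.mem_range.not.1 hn), ← wordSumₗ_apply, map_zero]]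
  exact Finset.sum_congr rfl fun n hn => by simp only [if_pos (Finset.mem_range.1 hn)]

end Words

/-! ### Braided derivations and Nichols algebras -/

section BraidedDerivation

variable {ι : Type*} [Fintype ι] [DecidableEq ι] (Ψ : Matrix (ι × ι) (ι × ι) ℂ)
  {A : Type*} [Ring A] [Algebra ℂ A] (x : ι → A)

/-- A family of braided partial derivatives with respect to the elements `x i`: on words in the
`x i` it strips the last letter after braiding each letter in turn to the end. -/
structure IsBraidedDerivation (D : ι → A →ₗ[ℂ] A) : Prop where
  map_one : ∀ s, D s 1 = 0
  map_mul : ∀ s p j, D s (p * x j)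
    = (if s = j then p else 0) + ∑ i, ∑ k, Ψ (k, s) (i, j) • (D i p * x k)

namespace IsBraidedDerivation

variable {Ψ x} {D : ι → A →ₗ[ℂ] A} (hD : IsBraidedDerivation Ψ x D)
include hD

theorem map_wordSum_zero (a : (Fin 0 → ι) → ℂ) (s : ι) : D s (wordSum x a) = 0 := by
  rw [wordSum_zero, Algebra.algebraMap_eq_smul_one, map_smul, hD.map_one, smul_zero]

theorem map_wordSum_eq_add {n : ℕ} (a : (Fin (n + 1) → ι) → ℂ) (s : ι) :
    D s (wordSum x a) = wordSum x (slice a s)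
      + ∑ k, (∑ i, ∑ j, Ψ (k, s) (i, j) • D i (wordSum x (slice a j))) * x k := by
  rw [wordSum_succ, map_sum]
  simp only [hD.map_mul, Finset.sum_add_distrib, Finset.sum_ite_eq, Finset.mem_univ, if_true,
    Finset.sum_mul, smul_mul_assoc]
  rw [Finset.sum_comm_cycle]
  exact congrArg _ (Finset.sum_congr rfl fun k _ => Finset.sum_comm)

theorem map_wordSum {n : ℕ} (a : (Fin (n + 1) → ι) → ℂ) (s : ι) :
    D s (wordSum x a) = wordSum x (slice (braidedInt Ψ (n + 1) (n + 1) *ᵥ a) s) := by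
  induction n generalizing s with
  | zero =>
    rw [hD.map_wordSum_eq_add, show braidedInt Ψ (0 + 1) (0 + 1) = 1 from braidedInt_one Ψ _,
      Matrix.one_mulVec]
    simp only [hD.map_wordSum_zero, smul_zero, Finset.sum_const_zero, zero_mul, add_zero]
  | succ n ih =>
    rw [hD.map_wordSum_eq_add, slice_braidedInt_mulVec, ← wordSumₗ_apply x (_ + _), map_add,
      wordSumₗ_apply, wordSumₗ_apply, wordSum_succ x (slice (adjLeg _ _ _ *ᵥ _) _)]
    simp only [ih, slice_slice_adjLeg_mulVec, slice_extendRight_mulVec]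
    simp only [← wordSumₗ_apply, map_sum, map_smul]

theorem map_sum_wordSum (N : ℕ) (a : ∀ n, (Fin n → ι) → ℂ) (s : ι) :
    D s (∑ n ∈ Finset.range (N + 1), wordSum x (a n)) = ∑ n ∈ Finset.range N,
      wordSum x (slice (braidedInt Ψ (n + 1) (n + 1) *ᵥ a (n + 1)) s) := by
  rw [map_sum, Finset.sum_range_succ', hD.map_wordSum_zero, add_zero]
  simp only [hD.map_wordSum]

theorem braidedFactorial_mulVec_eq_zero {E : Type*} [AddCommGroup E] [Module ℂ E] {ε : A →ₗ[ℂ] E}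
    (hε1 : ε 1 ≠ 0) (hεx : ∀ p j, ε (p * x j) = 0) {N : ℕ} {a : ∀ n, (Fin n → ι) → ℂ}
    (h0 : ε (∑ n ∈ Finset.range N, wordSum x (a n)) = 0)
    (h : ∀ s, D s (∑ n ∈ Finset.range N, wordSum x (a n)) = 0) {n : ℕ} (hn : n < N) :
    braidedFactorial Ψ n *ᵥ a n = 0 := by
  induction N generalizing a n with
  | zero => exact absurd hn n.not_lt_zero
  | succ N ih =>
    cases n with
    | zero =>
      rw [Finset.sum_range_succ', map_add, map_sum,
        Finset.sum_eq_zero fun n _ => map_wordSum_succ_eq_zero hεx _, zero_add, wordSum_zero,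
        Algebra.algebraMap_eq_smul_one, map_smul] at h0
      have ha : a 0 = 0 := funext fun w => by
        rw [Subsingleton.elim w Fin.elim0]
        exact (smul_eq_zero.1 h0).resolve_right hε1
      rw [ha, Matrix.mulVec_zero]
    | succ n =>
      refine (braidedFactorial_mulVec_eq_zero_iff Ψ _).2 fun s => ?_
      have hs := (hD.map_sum_wordSum N a s).symm.trans (h s)
      exact ih (a := fun n => slice (braidedInt Ψ (n + 1) (n + 1) *ᵥ a (n + 1)) s)
        (by rw [hs, map_zero]) (fun r => by rw [hs, map_zero]) (Nat.lt_of_succ_lt_succ hn)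

theorem wordSum_eq_zero {E : Type*} [AddCommGroup E] [Module ℂ E] {ε : A →ₗ[ℂ] E}
    (hεx : ∀ p j, ε (p * x j) = 0) (hsep : ∀ p, ε p = 0 → (∀ s, D s p = 0) → p = 0) {n : ℕ}
    {a : (Fin n → ι) → ℂ} (h : braidedFactorial Ψ n *ᵥ a = 0) : wordSum x a = 0 := by
  induction n with
  | zero =>
    have ha : a = 0 := by simpa [braidedFactorial] using h
    rw [ha, ← wordSumₗ_apply, map_zero]
  | succ n ih =>
    refine hsep _ (map_wordSum_succ_eq_zero hεx a) fun s => ?_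
    rw [hD.map_wordSum, ih ((braidedFactorial_mulVec_eq_zero_iff Ψ a).1 h s)]

section

variable {E κ : Type*} [AddCommGroup E] [Module ℂ E] {ε : A →ₗ[ℂ] E}
  (hεx : ∀ p j, ε (p * x j) = 0) (hsep : ∀ p, ε p = 0 → (∀ s, D s p = 0) → p = 0)
include hεx hsep

theorem sum_wordSum_eq_algebraMap {N : ℕ} {a : ∀ n, (Fin n → ι) → ℂ}
    (h : ∀ s, D s (∑ n ∈ Finset.range (N + 1), wordSum x (a n)) = 0) :
    ∑ n ∈ Finset.range (N + 1), wordSum x (a n) = algebraMap ℂ A (a 0 Fin.elim0) := by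
  refine sub_eq_zero.1 (hsep _ ?_ fun s => ?_)
  · rw [Finset.sum_range_succ', wordSum_zero, add_sub_cancel_right, map_sum]
    exact Finset.sum_eq_zero fun n _ => map_wordSum_succ_eq_zero hεx _
  · rw [map_sub, h, Algebra.algebraMap_eq_smul_one, map_smul, hD.map_one, smul_zero, sub_zero]

variable {e : κ → A} (he : LinearIndependent ℂ fun k => ε (e k))
  (hDe : ∀ s k p, D s (e k * p) = e k * D s p) {t : Finset κ}
include he hDe

theorem sum_wordSum_eq_zero_of_sum_mul_eq_zero {N : ℕ} {a : κ → ∀ n, (Fin n → ι) → ℂ}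
    (h : ∑ k ∈ t, e k * ∑ n ∈ Finset.range N, wordSum x (a k n) = 0) :
    ∀ k ∈ t, ∑ n ∈ Finset.range N, wordSum x (a k n) = 0 := by
  induction N generalizing a with
  | zero => exact fun k _ => Finset.sum_range_zero _
  | succ N ih =>
    have hconst : ∀ k ∈ t, ∑ n ∈ Finset.range (N + 1), wordSum x (a k n)
        = algebraMap ℂ A (a k 0 Fin.elim0) := fun k hk =>
      hD.sum_wordSum_eq_algebraMap hεx hsep fun s => by
        rw [hD.map_sum_wordSum]
        refine ih (a := fun k n => slice (braidedInt Ψ (n + 1) (n + 1) *ᵥ a k (n + 1)) s) ?_ k hk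
        simp only [← hD.map_sum_wordSum, ← hDe, ← map_sum]
        rw [h, map_zero]
    have hz : ∑ k ∈ t, a k 0 Fin.elim0 • ε (e k) = 0 := by
      rw [Finset.sum_congr rfl fun k hk => congrArg (e k * ·) (hconst k hk)] at h
      simpa only [← Algebra.commutes, ← Algebra.smul_def, map_sum, map_smul, map_zero]
        using congrArg ε h
    intro k hk
    rw [hconst k hk, linearIndependent_iff'.1 he t _ hz k hk, map_zero]

theorem eq_zero_of_sum_mul_eq_zero {p : κ → A}
    (hp : ∀ k ∈ t, p k ∈ Algebra.adjoin ℂ (Set.range x)) (h : ∑ k ∈ t, e k * p k = 0) :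
    ∀ k ∈ t, p k = 0 := by
  obtain ⟨N, a, ha⟩ := exists_forall_eq_sum_wordSum hp
  intro k hk
  rw [ha k hk]
  refine hD.sum_wordSum_eq_zero_of_sum_mul_eq_zero hεx hsep he hDe ?_ k hk
  rw [← h]
  exact Finset.sum_congr rfl fun k hk => by rw [ha k hk]

end

end IsBraidedDerivation

namespace Nichols

theorem wordSum_gen_eq_zero {n : ℕ} {a : (Fin n → ι) → ℂ} (h : braidedFactorial Ψ n *ᵥ a = 0) :
    wordSum (gen Ψ) a = 0 := by
  have hrel := RingQuot.mkAlgHom_rel ℂ (NicholsRel.ker n a h)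
  rwa [map_zero, map_wordSum] at hrel

theorem adjoin_range_gen : Algebra.adjoin ℂ (Set.range (gen Ψ)) = ⊤ := by
  have hrange : Set.range (gen Ψ)
      = RingQuot.mkAlgHom ℂ (NicholsRel Ψ) '' Set.range (FreeAlgebra.ι ℂ) := by
    rw [← Set.range_comp]; rfl
  rw [hrange, ← AlgHom.map_adjoin, FreeAlgebra.adjoin_range_ι, Algebra.map_top,
    (AlgHom.range_eq_top _).2 (RingQuot.mkAlgHom_surjective ℂ _)]

variable {Ψ x}

theorem mem_adjoin_range_gen (b : Nichols Ψ) : b ∈ Algebra.adjoin ℂ (Set.range (gen Ψ)) := by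
  simp [adjoin_range_gen]

theorem algHom_ext {A : Type*} [Semiring A] [Algebra ℂ A] {f g : Nichols Ψ →ₐ[ℂ] A}
    (h : ∀ i, f (gen Ψ i) = g (gen Ψ i)) : f = g :=
  RingQuot.ringQuot_ext' ℂ f g (FreeAlgebra.hom_ext (funext h))

/-- The homomorphism from the Nichols algebra that sends the generators to given elements
satisfying its relations. -/
def lift (h : ∀ n (a : (Fin n → ι) → ℂ), braidedFactorial Ψ n *ᵥ a = 0 → wordSum x a = 0) :
    Nichols Ψ →ₐ[ℂ] A :=
  RingQuot.liftAlgHom ℂ ⟨FreeAlgebra.lift ℂ x, fun _ _ hr => by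
    obtain ⟨n, a, hr⟩ := hr
    rw [map_zero, map_wordSum]
    simpa only [FreeAlgebra.lift_ι_apply] using h n a hr⟩

@[simp]
theorem lift_gen (h : ∀ n (a : (Fin n → ι) → ℂ), braidedFactorial Ψ n *ᵥ a = 0 → wordSum x a = 0)
    (i : ι) : lift h (gen Ψ i) = x i := by
  rw [lift, gen, RingQuot.liftAlgHom_mkAlgHom_apply, FreeAlgebra.lift_ι_apply]

theorem lift_wordSum
    (h : ∀ n (a : (Fin n → ι) → ℂ), braidedFactorial Ψ n *ᵥ a = 0 → wordSum x a = 0)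
    {n : ℕ} (a : (Fin n → ι) → ℂ) : lift h (wordSum (gen Ψ) a) = wordSum x a := by
  simp only [map_wordSum, lift_gen]

section

variable {D : ι → A →ₗ[ℂ] A} {E : Type*} [AddCommGroup E] [Module ℂ E] {ε : A →ₗ[ℂ] E}

theorem lift_injective
    (h : ∀ n (a : (Fin n → ι) → ℂ), braidedFactorial Ψ n *ᵥ a = 0 → wordSum x a = 0)
    (hD : IsBraidedDerivation Ψ x D) (hε1 : ε 1 ≠ 0) (hεx : ∀ p j, ε (p * x j) = 0) :
    Function.Injective (lift h) := by
  refine (injective_iff_map_eq_zero _).2 fun p hp => ?_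
  obtain ⟨N, a, rfl⟩ := exists_eq_sum_wordSum (mem_adjoin_range_gen p)
  simp only [map_sum, lift_wordSum] at hp
  exact Finset.sum_eq_zero fun n hn => wordSum_gen_eq_zero Ψ <|
    hD.braidedFactorial_mulVec_eq_zero hε1 hεx (by rw [hp, map_zero])
      (fun s => by rw [hp, map_zero]) (Finset.mem_range.1 hn)

end

theorem eq_zero_of_derivations_eq_zero {D : ι → Nichols Ψ →ₗ[ℂ] Nichols Ψ}
    (hD : IsBraidedDerivation Ψ (gen Ψ) D) {E : Type*} [AddCommGroup E] [Module ℂ E]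
    {ε : Nichols Ψ →ₗ[ℂ] E} (hε1 : ε 1 ≠ 0) (hεx : ∀ p j, ε (p * gen Ψ j) = 0) {b : Nichols Ψ}
    (h0 : ε b = 0) (h : ∀ s, D s b = 0) : b = 0 := by
  obtain ⟨N, a, rfl⟩ := exists_eq_sum_wordSum (mem_adjoin_range_gen b)
  exact Finset.sum_eq_zero fun n hn => wordSum_gen_eq_zero Ψ <|
    hD.braidedFactorial_mulVec_eq_zero hε1 hεx h0 h (Finset.mem_range.1 hn)

variable (Ψ) in
/-- The counit of the Nichols algebra, which reads off the constant term. -/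
def counit : Nichols Ψ →ₐ[ℂ] ℂ :=
  lift (x := 0) fun n a h => by
    cases n with
    | zero =>
      have ha : a = 0 := by simpa [braidedFactorial] using h
      rw [ha, ← wordSumₗ_apply, map_zero]
    | succ n =>
      rw [wordSum_succ]
      exact Finset.sum_eq_zero fun s _ => mul_zero _

@[simp]
theorem counit_gen (i : ι) : counit Ψ (gen Ψ i) = 0 := lift_gen _ i

open scoped Kronecker

/-- The endomorphism of the Nichols algebra induced by an operator that commutes with the
braiding. -/
def mapEnd (M : Matrix ι ι ℂ) (h : Commute (M ⊗ₖ M) Ψ) : Nichols Ψ →ₐ[ℂ] Nichols Ψ :=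
  lift (x := fun s => ∑ r, M r s • gen Ψ r) fun n a ha => by
    rw [← wordSum_tensorPow]
    refine wordSum_gen_eq_zero Ψ ?_
    rw [Matrix.mulVec_mulVec, ← (commute_tensorPow_braidedFactorial h n).eq,
      ← Matrix.mulVec_mulVec, ha, Matrix.mulVec_zero]

@[simp]
theorem mapEnd_gen (M : Matrix ι ι ℂ) (h : Commute (M ⊗ₖ M) Ψ) (s : ι) :
    mapEnd M h (gen Ψ s) = ∑ r, M r s • gen Ψ r :=
  lift_gen _ s

end Nichols

end BraidedDerivation

/-! ### The Nichols algebra of the Yetter-Drinfeld module -/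

section YetterDrinfeld

variable {V : Type*} [AddCommGroup V] [Module ℂ V]
  {G : Subgroup (LinearMap.GeneralLinearGroup ℂ V)}

namespace Refl

theorem conj_val (g : G) (s : Refl G) : (s.conj g).1 = g * s.1 * g⁻¹ := rfl

theorem conj_mul (g h : G) (s : Refl G) : s.conj (g * h) = (s.conj h).conj g :=
  Subtype.ext (by simp [conj, mul_assoc])

@[simp]
theorem conj_one (s : Refl G) : s.conj 1 = s := Subtype.ext (by simp [conj])

theorem conj_injective (g : G) : Function.Injective (conj g) :=
  Function.LeftInverse.injective (g := conj g⁻¹) fun s => by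
    rw [← conj_mul, inv_mul_cancel, conj_one]

theorem conj_val_mul (g : G) (s : Refl G) : (s.conj g).1 * g = g * s.1 :=
  inv_mul_cancel_right _ _

theorem conj_conj (g : G) (r s : Refl G) :
    (s.conj g).conj (r.conj g).1 = (s.conj r.1).conj g := by
  rw [← conj_mul, conj_val_mul, conj_mul]

end Refl

namespace RootData

variable (R : RootData G)

theorem exists_root_smul_coroot_ne_zero (s : Refl G) : ∃ v, R.root s v • R.coroot s ≠ 0 := by
  by_contra! h
  have h0 : (1 - natRep G s.1 : V →ₗ[ℂ] V) = 0 := by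
    ext v
    simp [R.apply_eq, h]
  have hs : Module.finrank ℂ (LinearMap.range (1 - natRep G s.1)) = 1 := s.2
  rw [h0, LinearMap.range_zero, finrank_bot] at hs
  exact zero_ne_one hs

theorem coroot_ne_zero (s : Refl G) : R.coroot s ≠ 0 := fun h => by
  obtain ⟨v, hv⟩ := R.exists_root_smul_coroot_ne_zero s
  exact hv (by rw [h, smul_zero])

theorem root_ne_zero (s : Refl G) : R.root s ≠ 0 := fun h => by
  obtain ⟨v, hv⟩ := R.exists_root_smul_coroot_ne_zero s
  exact hv (by rw [h, LinearMap.zero_apply, zero_smul])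

@[simp]
theorem cocycle_one (s : Refl G) : R.cocycle 1 s = 1 := by
  refine smul_left_injective ℂ (R.coroot_ne_zero (s.conj 1)) ?_
  simp only
  rw [← R.cocycle_spec, Refl.conj_one, map_one, one_smul, Module.End.one_apply]

theorem cocycle_mul (g h : G) (s : Refl G) :
    R.cocycle (g * h) s = R.cocycle g (s.conj h) * R.cocycle h s := by
  refine smul_left_injective ℂ (R.coroot_ne_zero (s.conj (g * h))) ?_
  simp only
  rw [← R.cocycle_spec, map_mul, Module.End.mul_apply, R.cocycle_spec h, map_smul, R.cocycle_spec g,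
    smul_smul, Refl.conj_mul, mul_comm]

theorem cocycle_inv_mul (g : G) (s : Refl G) :
    R.cocycle g⁻¹ (s.conj g) * R.cocycle g s = 1 := by
  rw [← cocycle_mul, inv_mul_cancel, cocycle_one]

theorem cocycle_ne_zero (g : G) (s : Refl G) : R.cocycle g s ≠ 0 :=
  right_ne_zero_of_mul_eq_one (R.cocycle_inv_mul g s)

theorem cocycle_conj (g : G) (r s : Refl G) :
    R.cocycle (r.conj g).1 (s.conj g) * R.cocycle g s
      = R.cocycle g (s.conj r.1) * R.cocycle r.1 s := by
  rw [← cocycle_mul, Refl.conj_val_mul, cocycle_mul]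

theorem braiding_apply (k l r s : Refl G) :
    R.braiding (k, l) (r, s) = if k = s.conj r.1 ∧ l = r then R.cocycle r.1 s else 0 :=
  rfl

/-- The action of `g` on the tensor algebra of `Y_G`. -/
def freeAct (g : G) : FreeAlgebra ℂ (Refl G) →ₐ[ℂ] FreeAlgebra ℂ (Refl G) :=
  FreeAlgebra.lift ℂ fun s => R.cocycle g s • FreeAlgebra.ι ℂ (s.conj g)

/-- The homomorphism to triangular matrices whose upper right entry is the braided derivative
of the tensor algebra in the direction `[r]`. -/
def freeDerivMatrix (r : Refl G) :
    FreeAlgebra ℂ (Refl G) →ₐ[ℂ] Matrix (Fin 2) (Fin 2) (FreeAlgebra ℂ (Refl G)) :=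
  FreeAlgebra.lift ℂ fun s => !![FreeAlgebra.ι ℂ s, if r = s then 1 else 0;
    0, R.freeAct r.1 (FreeAlgebra.ι ℂ s)]

theorem freeDerivMatrix_apply (r : Refl G) (p : FreeAlgebra ℂ (Refl G)) :
    R.freeDerivMatrix r p = !![p, upperRight (R.freeDerivMatrix r) p; 0, R.freeAct r.1 p] :=
  eq_triangular_upperRight (FreeAlgebra.adjoin_range_ι ℂ (Refl G))
    (d := upperRight (R.freeDerivMatrix r))
    (by rintro _ ⟨s, rfl⟩; simp [upperRight, freeDerivMatrix]) p

variable [Finite G]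

theorem isBraidedDerivation_of_isSkewDerivation {A : Type*} [Ring A] [Algebra ℂ A]
    {x : Refl G → A} {θ : Refl G → A →ₐ[ℂ] A} {D : Refl G → A →ₗ[ℂ] A}
    (hD : ∀ r, IsSkewDerivation (θ r) (D r)) (hDx : ∀ r s, D r (x s) = if r = s then 1 else 0)
    (hθ : ∀ r s, θ r (x s) = R.cocycle r.1 s • x (s.conj r.1)) :
    IsBraidedDerivation R.braiding x D where
  map_one r := (hD r).map_one
  map_mul r p s := by
    rw [hD, hDx, hθ, mul_ite, mul_one, mul_zero, mul_smul_comm,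
      Fintype.sum_eq_single r fun i hi => Finset.sum_eq_zero fun k _ => by
        rw [braiding_apply, if_neg fun h => hi h.2.symm, zero_smul],
      Fintype.sum_eq_single (s.conj r.1) fun k hk => by
        rw [braiding_apply, if_neg fun h => hk h.1, zero_smul],
      braiding_apply, if_pos (And.intro rfl rfl)]

/-- The matrix of the action of `g` on `Y_G`. -/
def actMatrix (g : G) : Matrix (Refl G) (Refl G) ℂ :=
  Matrix.of fun k s => if k = s.conj g then R.cocycle g s else 0

theorem sum_actMatrix_smul {M : Type*} [AddCommMonoid M] [Module ℂ M] (g : G) (s : Refl G)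
    (f : Refl G → M) : ∑ k, R.actMatrix g k s • f k = R.cocycle g s • f (s.conj g) := by
  simp [actMatrix]

open scoped Kronecker in
theorem commute_actMatrix_kronecker_braiding (g : G) :
    Commute (R.actMatrix g ⊗ₖ R.actMatrix g) R.braiding := by
  ext ⟨k, l⟩ ⟨r, s⟩
  rw [Matrix.mul_apply, Matrix.mul_apply,
    Fintype.sum_eq_single (s.conj r.1, r) fun ⟨i, j⟩ hij => by
      rw [braiding_apply, if_neg fun h => hij (Prod.ext h.1 h.2), mul_zero],
    Fintype.sum_eq_single (r.conj g, s.conj g) fun ⟨i, j⟩ hij => by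
      rw [Matrix.kroneckerMap_apply, actMatrix, Matrix.of_apply, Matrix.of_apply,
        ite_zero_mul_ite_zero, if_neg fun h => hij (Prod.ext h.1 h.2), mul_zero]]
  simp only [Matrix.kroneckerMap_apply, actMatrix, Matrix.of_apply, braiding_apply,
    Refl.conj_conj, if_true, and_self, ite_zero_mul_ite_zero]
  rw [ite_zero_mul]
  split_ifs
  · linear_combination -R.cocycle g r * R.cocycle_conj g r s
  · rw [zero_mul]

/-- The action of `g` on `B(Y_G)`. -/
def act (g : G) : Nichols R.braiding →ₐ[ℂ] Nichols R.braiding :=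
  Nichols.mapEnd (R.actMatrix g) (R.commute_actMatrix_kronecker_braiding g)

@[simp]
theorem act_gen (g : G) (s : Refl G) : R.act g (Nichols.gen R.braiding s)
    = R.cocycle g s • Nichols.gen R.braiding (s.conj g) := by
  rw [act, Nichols.mapEnd_gen, sum_actMatrix_smul]

theorem act_mul (g h : G) : R.act (g * h) = (R.act g).comp (R.act h) :=
  Nichols.algHom_ext fun s => by
    simp [cocycle_mul, Refl.conj_mul, smul_smul, mul_comm]

theorem act_one : R.act 1 = AlgHom.id ℂ _ :=
  Nichols.algHom_ext fun s => by simp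

theorem isBraidedDerivation_free : IsBraidedDerivation R.braiding (FreeAlgebra.ι ℂ)
    fun r => upperRight (R.freeDerivMatrix r) :=
  R.isBraidedDerivation_of_isSkewDerivation
    (fun r => isSkewDerivation_upperRight (FreeAlgebra.adjoin_range_ι ℂ (Refl G))
      fun p _ => R.freeDerivMatrix_apply r p)
    (fun r s => by simp [upperRight, freeDerivMatrix]) (fun r s => by simp [freeAct])

theorem mkAlgHom_freeAct (g : G) (p : FreeAlgebra ℂ (Refl G)) :
    RingQuot.mkAlgHom ℂ (NicholsRel R.braiding) (R.freeAct g p)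
      = R.act g (RingQuot.mkAlgHom ℂ (NicholsRel R.braiding) p) := by
  have : (RingQuot.mkAlgHom ℂ (NicholsRel R.braiding)).comp (R.freeAct g)
      = (R.act g).comp (RingQuot.mkAlgHom ℂ (NicholsRel R.braiding)) :=
    FreeAlgebra.hom_ext <| funext fun s => by
      refine Eq.trans ?_ (R.act_gen g s).symm
      simp only [Function.comp_apply, AlgHom.comp_apply, freeAct, FreeAlgebra.lift_ι_apply,
        map_smul, Nichols.gen]
  exact DFunLike.congr_fun this p

theorem mapMatrix_freeDerivMatrix_wordSum_eq_zero (r : Refl G) {n : ℕ}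
    {a : (Fin n → Refl G) → ℂ} (h : braidedFactorial R.braiding n *ᵥ a = 0) :
    (RingQuot.mkAlgHom ℂ (NicholsRel R.braiding)).mapMatrix
      (R.freeDerivMatrix r (wordSum (FreeAlgebra.ι ℂ) a)) = 0 := by
  have hmk {n : ℕ} {a : (Fin n → Refl G) → ℂ} (h : braidedFactorial R.braiding n *ᵥ a = 0) :
      RingQuot.mkAlgHom ℂ (NicholsRel R.braiding) (wordSum (FreeAlgebra.ι ℂ) a) = 0 :=
    (RingQuot.mkAlgHom_rel ℂ (NicholsRel.ker n a h)).trans (map_zero _)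
  have hderiv : RingQuot.mkAlgHom ℂ (NicholsRel R.braiding)
      (upperRight (R.freeDerivMatrix r) (wordSum (FreeAlgebra.ι ℂ) a)) = 0 := by
    cases n with
    | zero => rw [R.isBraidedDerivation_free.map_wordSum_zero, map_zero]
    | succ n =>
      rw [R.isBraidedDerivation_free.map_wordSum]
      exact hmk ((braidedFactorial_mulVec_eq_zero_iff _ a).1 h r)
  rw [freeDerivMatrix_apply]
  ext i j
  fin_cases i <;> fin_cases j <;> simp [hderiv, hmk h, mkAlgHom_freeAct]

/-- The homomorphism to triangular matrices whose upper right entry is the braided derivative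
of `B(Y_G)` in the direction `[r]`. -/
def derivMatrix (r : Refl G) :
    Nichols R.braiding →ₐ[ℂ] Matrix (Fin 2) (Fin 2) (Nichols R.braiding) :=
  Nichols.lift (x := fun s => ((RingQuot.mkAlgHom ℂ (NicholsRel R.braiding)).mapMatrix.comp
    (R.freeDerivMatrix r)) (FreeAlgebra.ι ℂ s)) fun _ a h =>
      (map_wordSum _ _ a).symm.trans (R.mapMatrix_freeDerivMatrix_wordSum_eq_zero r h)

/-- The braided derivative of `B(Y_G)` in the direction `[r]`. -/
def deriv (r : Refl G) : Nichols R.braiding →ₗ[ℂ] Nichols R.braiding :=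
  upperRight (R.derivMatrix r)

theorem derivMatrix_gen (r s : Refl G) : R.derivMatrix r (Nichols.gen R.braiding s) =
    !![Nichols.gen R.braiding s, if r = s then 1 else 0;
      0, R.act r.1 (Nichols.gen R.braiding s)] := by
  rw [derivMatrix, Nichols.lift_gen]
  ext i j
  fin_cases i <;> fin_cases j <;>
    simp [freeDerivMatrix, mkAlgHom_freeAct, Nichols.gen, apply_ite (RingQuot.mkAlgHom ℂ _)]

@[simp]
theorem deriv_gen (r s : Refl G) :
    R.deriv r (Nichols.gen R.braiding s) = if r = s then 1 else 0 :=
  upperRight_apply_of_eq (R.derivMatrix_gen r s)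

theorem isSkewDerivation_deriv (r : Refl G) : IsSkewDerivation (R.act r.1) (R.deriv r) :=
  isSkewDerivation_upperRight (Nichols.adjoin_range_gen _) (d := R.deriv r) <| by
    rintro _ ⟨s, rfl⟩
    rw [derivMatrix_gen, deriv_gen]

theorem eq_zero_of_deriv_eq_zero {b : Nichols R.braiding} (h0 : Nichols.counit R.braiding b = 0)
    (h : ∀ r, R.deriv r b = 0) : b = 0 :=
  Nichols.eq_zero_of_derivations_eq_zero
    (R.isBraidedDerivation_of_isSkewDerivation R.isSkewDerivation_deriv R.deriv_gen
      fun r s => R.act_gen r.1 s)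
    (ε := (Nichols.counit R.braiding).toLinearMap) (by simp) (by simp) h0 h

theorem deriv_act (g : G) (r : Refl G) (b : Nichols R.braiding) :
    R.deriv (r.conj g) (R.act g b) = R.cocycle g r • R.act g (R.deriv r b) := by
  have hb : b ∈ Algebra.adjoin ℂ (Set.range (Nichols.gen R.braiding)) := by
    simp [Nichols.adjoin_range_gen]
  induction hb using Algebra.adjoin_induction with
  | mem b hb =>
    obtain ⟨s, rfl⟩ := hb
    simp only [act_gen, map_smul, deriv_gen, (Refl.conj_injective g).eq_iff]
    split_ifs with hrs
    · rw [hrs, map_one]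
    · rw [map_zero, smul_zero, smul_zero]
  | algebraMap z =>
    simp only [Algebra.algebraMap_eq_smul_one, map_smul, map_one,
      (R.isSkewDerivation_deriv _).map_one, map_zero, smul_zero]
  | add p q _ _ hp hq => simp only [map_add, hp, hq, smul_add]
  | mul p q _ _ hp hq =>
    have hact : R.act (r.conj g).1 (R.act g q) = R.act g (R.act r.1 q) := by
      rw [← AlgHom.comp_apply, ← AlgHom.comp_apply, ← act_mul, ← act_mul, Refl.conj_val_mul]
    rw [map_mul, R.isSkewDerivation_deriv, R.isSkewDerivation_deriv, hp, hq, hact, map_add,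
      map_mul, map_mul, smul_add, mul_smul_comm, smul_mul_assoc]

end RootData

end YetterDrinfeld

/-! ### The representation of the braided Heisenberg double -/

section Operators

section

variable {K A : Type*} [CommRing K] [Ring A] [Algebra K A]

theorem mem_of_mul_right_mem {s : Set A} {P : Submodule K A} (h1 : 1 ∈ P)
    (hmul : ∀ p ∈ P, ∀ u ∈ s, p * u ∈ P) {q : A} (hq : q ∈ Algebra.adjoin K s) : q ∈ P := by
  suffices ∀ p ∈ P, p * q ∈ P by simpa using this 1 h1
  induction hq using Algebra.adjoin_induction with
  | mem u hu => exact fun p hp => hmul p hp u hu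
  | algebraMap z =>
    intro p hp
    rw [← Algebra.commutes, ← Algebra.smul_def]
    exact P.smul_mem z hp
  | add q r _ _ hq hr =>
    intro p hp
    rw [mul_add]
    exact P.add_mem (hq p hp) (hr p hp)
  | mul q r _ _ hq hr =>
    intro p hp
    rw [← mul_assoc]
    exact hr _ (hq p hp)

theorem mem_of_mul_left_mem {s : Set A} {P : Submodule K A} (h1 : 1 ∈ P)
    (hmul : ∀ u ∈ s, ∀ p ∈ P, u * p ∈ P) {q : A} (hq : q ∈ Algebra.adjoin K s) : q ∈ P := by
  suffices ∀ p ∈ P, q * p ∈ P by simpa using this 1 h1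
  induction hq using Algebra.adjoin_induction with
  | mem u hu => exact hmul u hu
  | algebraMap z =>
    intro p hp
    rw [← Algebra.smul_def]
    exact P.smul_mem z hp
  | add q r _ _ hq hr =>
    intro p hp
    rw [add_mul]
    exact P.add_mem (hq p hp) (hr p hp)
  | mul q r _ _ hq hr =>
    intro p hp
    rw [mul_assoc]
    exact hq _ (hr p hp)

/-- The twisted commutator `p ↦ (p y - y p) u⁻¹`. -/
def twistedComm (u : Aˣ) (y : A) : A →ₗ[K] A :=
  LinearMap.mulRight K (↑u⁻¹ : A) ∘ₗ (LinearMap.mulRight K y - LinearMap.mulLeft K y)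

theorem twistedComm_apply (u : Aˣ) (y p : A) :
    twistedComm (K := K) u y p = (p * y - y * p) * ↑u⁻¹ := rfl

theorem isSkewDerivation_twistedComm (u : Aˣ) (y : A) :
    IsSkewDerivation (MulSemiringAction.toAlgHom K A (ConjAct.toConjAct u)) (twistedComm u y) := by
  intro p q
  rw [MulSemiringAction.toAlgHom_apply, ConjAct.units_smul_def, ConjAct.ofConjAct_toConjAct]
  simp only [twistedComm_apply, ← mul_assoc, Units.inv_mul_cancel_right]
  noncomm_ring

end

-- This shortcut is what makes the ring structure on `MonoidAlgebra (Module.End ℂ (Nichols Ψ)) G`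
-- available to instance search.
instance {ι : Type*} [Fintype ι] [DecidableEq ι] (Ψ : Matrix (ι × ι) (ι × ι) ℂ) :
    Ring (Nichols Ψ) :=
  inferInstance

variable {V : Type*} [AddCommGroup V] [Module ℂ V]
  {G : Subgroup (LinearMap.GeneralLinearGroup ℂ V)} [Finite G] (R : RootData G)

namespace RootData

/-- The algebra `End B(Y_G) ⊗ ℂG`, in which the braided Heisenberg double is represented. The
factor `ℂG` records the degree by which an operator shifts the `G`-grading. -/
abbrev Op := MonoidAlgebra (Module.End ℂ (Nichols R.braiding)) G

/-- The image of `[s]`: multiplication on the left. -/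
def opY (s : Refl G) : R.Op :=
  MonoidAlgebra.single 1 (LinearMap.mulLeft ℂ (Nichols.gen R.braiding s))

/-- The image of `[s]*`: the braided derivative. -/
def opYstar (s : Refl G) : R.Op := MonoidAlgebra.single s.1 (R.deriv s)

/-- The image of a group element. -/
def opGrp : G →* R.Op where
  toFun g := MonoidAlgebra.single g (R.act g).toLinearMap
  map_one' := by rw [act_one]; rfl
  map_mul' g h := by rw [MonoidAlgebra.single_mul_single, act_mul]; rfl

theorem opGrp_mul_opY (g : G) (s : Refl G) :
    R.opGrp g * R.opY s = R.cocycle g s • (R.opY (s.conj g) * R.opGrp g) := by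
  have : (R.act g).toLinearMap * LinearMap.mulLeft ℂ (Nichols.gen R.braiding s) = R.cocycle g s •
      (LinearMap.mulLeft ℂ (Nichols.gen R.braiding (s.conj g)) * (R.act g).toLinearMap) := by
    ext b
    simp
  simp [opGrp, opY, MonoidAlgebra.single_mul_single, this]

theorem opGrp_mul_opYstar (g : G) (s : Refl G) :
    R.opGrp g * R.opYstar s = (R.cocycle g s)⁻¹ • (R.opYstar (s.conj g) * R.opGrp g) := by
  have : R.deriv (s.conj g) * (R.act g).toLinearMap
      = R.cocycle g s • ((R.act g).toLinearMap * R.deriv s) :=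
    LinearMap.ext (R.deriv_act g s)
  simp [opGrp, opYstar, MonoidAlgebra.single_mul_single, this, Refl.conj_val_mul,
    smul_smul, R.cocycle_ne_zero g s]

theorem opYstar_mul_opY_sub (r s : Refl G) :
    R.opYstar r * R.opY s - R.opY s * R.opYstar r = if r = s then R.opGrp s.1 else 0 := by
  have : R.deriv r * LinearMap.mulLeft ℂ (Nichols.gen R.braiding s)
      - LinearMap.mulLeft ℂ (Nichols.gen R.braiding s) * R.deriv r
      = if r = s then (R.act s.1).toLinearMap else 0 := by
    ext b
    rw [LinearMap.sub_apply, Module.End.mul_apply, Module.End.mul_apply, LinearMap.mulLeft_apply,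
      LinearMap.mulLeft_apply, R.isSkewDerivation_deriv r, add_sub_cancel_left, deriv_gen]
    split_ifs with hrs <;> simp [hrs]
  rw [opY, opYstar, MonoidAlgebra.single_mul_single, MonoidAlgebra.single_mul_single, mul_one,
    one_mul, ← MonoidAlgebra.single_sub, this]
  split_ifs with hrs <;> simp [hrs, opGrp]

/-- Multiplication on the right by `[s]`. -/
def mulGen (s : Refl G) : Module.End ℂ (Nichols R.braiding) :=
  LinearMap.mulRight ℂ (Nichols.gen R.braiding s)

theorem mulGen_apply (s : Refl G) (b : Nichols R.braiding) :
    R.mulGen s b = b * Nichols.gen R.braiding s := rfl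

theorem deriv_mul_mulGen (r s : Refl G) : R.deriv r * R.mulGen s
    = (if r = s then 1 else 0) + R.cocycle r.1 s • (R.mulGen (s.conj r.1) * R.deriv r) := by
  ext b
  simp only [Module.End.mul_apply, mulGen_apply, LinearMap.add_apply, LinearMap.smul_apply]
  rw [R.isSkewDerivation_deriv r, deriv_gen, act_gen, mul_smul_comm]
  split_ifs <;> simp

/-- The braided commutator with right multiplication by `[s]`. -/
def opDeriv (s : Refl G) : R.Op →ₗ[ℂ] R.Op :=
  Finsupp.lsum ℂ (fun g => MonoidAlgebra.lsingle (g * s.1⁻¹) ∘ₗ (LinearMap.mulRight ℂ (R.mulGen s)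
    - R.cocycle g s • LinearMap.mulLeft ℂ (R.mulGen (s.conj g))))
    ∘ₗ (MonoidAlgebra.coeffLinearEquiv ℂ).toLinearMap

theorem opDeriv_single (s : Refl G) (g : G) (T : Module.End ℂ (Nichols R.braiding)) :
    R.opDeriv s (MonoidAlgebra.single g T) = MonoidAlgebra.single (g * s.1⁻¹)
      (T * R.mulGen s - R.cocycle g s • (R.mulGen (s.conj g) * T)) := by
  simp [opDeriv, MonoidAlgebra.coeffLinearEquiv]

theorem coeff_opDeriv (s : Refl G) (p : R.Op) (g : G) : (R.opDeriv s p).coeff (g * s.1⁻¹)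
    = p.coeff g * R.mulGen s - R.cocycle g s • (R.mulGen (s.conj g) * p.coeff g) := by
  classical
  induction p using MonoidAlgebra.induction_linear with
  | zero => simp
  | add p q hp hq =>
    simp only [map_add, MonoidAlgebra.coeff_add, Finsupp.add_apply, hp, hq, add_mul, mul_add,
      smul_add]
    abel
  | single h T =>
    rw [opDeriv_single, MonoidAlgebra.coeff_single, MonoidAlgebra.coeff_single,
      Finsupp.single_apply, Finsupp.single_apply]
    by_cases hgh : h = g
    · simp [hgh]
    · simp [hgh]

theorem opDeriv_mul_opYstar (s j : Refl G) (p : R.Op) :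
    R.opDeriv s (p * R.opYstar j) = (if s = j then p else 0)
      + R.cocycle j.1 s • (R.opDeriv (s.conj j.1) p * R.opYstar j) := by
  induction p using MonoidAlgebra.induction_linear with
  | zero => simp
  | add p q hp hq =>
    simp only [add_mul, map_add, hp, hq, smul_add]
    split_ifs
    · abel
    · abel
  | single g T =>
    have hgroup : g * (s.conj j.1).1⁻¹ * j.1 = g * j.1 * s.1⁻¹ := by
      rw [Refl.conj_val]
      group
    have hop : T * R.deriv j * R.mulGen s
        - R.cocycle (g * j.1) s • (R.mulGen (s.conj (g * j.1)) * (T * R.deriv j))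
        = (if s = j then T else 0) + R.cocycle j.1 s • ((T * R.mulGen (s.conj j.1)
          - R.cocycle g (s.conj j.1) • (R.mulGen ((s.conj j.1).conj g) * T)) * R.deriv j) := by
      rw [mul_assoc T, deriv_mul_mulGen, cocycle_mul, Refl.conj_mul, mul_comm (R.cocycle g _),
        mul_add, mul_ite, mul_one, mul_zero, sub_mul, smul_sub, smul_mul_assoc, smul_smul,
        mul_smul_comm, mul_assoc, mul_assoc, add_sub_assoc]
      simp only [eq_comm]
    rw [opYstar, MonoidAlgebra.single_mul_single, opDeriv_single, opDeriv_single,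
      MonoidAlgebra.single_mul_single, hgroup, hop, MonoidAlgebra.single_add,
      MonoidAlgebra.smul_single]
    split_ifs with hsj
    · rw [hsj, mul_inv_cancel_right]
    · rw [MonoidAlgebra.single_zero]

theorem isBraidedDerivation_opDeriv : IsBraidedDerivation R.braidingᵀ R.opYstar R.opDeriv where
  map_one s := by
    rw [MonoidAlgebra.one_def, opDeriv_single, Refl.conj_one, cocycle_one, one_smul]
    exact (congrArg _ (sub_self _)).trans (MonoidAlgebra.single_zero _)
  map_mul s p j := by
    have hsum : ∑ i, ∑ k, R.braidingᵀ (k, s) (i, j) • (R.opDeriv i p * R.opYstar k)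
        = R.cocycle j.1 s • (R.opDeriv (s.conj j.1) p * R.opYstar j) := by
      simp only [Matrix.transpose_apply, braiding_apply, ite_and, ite_smul, zero_smul]
      rw [Finset.sum_comm]
      simp
    rw [opDeriv_mul_opYstar, hsum]

/-- Evaluation of the operator components at `1`. -/
def evalOne : R.Op →ₗ[ℂ] G →₀ Nichols R.braiding :=
  Finsupp.mapRange.linearMap (LinearMap.applyₗ 1)
    ∘ₗ (MonoidAlgebra.coeffLinearEquiv ℂ).toLinearMap

theorem evalOne_apply (p : R.Op) (g : G) : R.evalOne p g = p.coeff g 1 := rfl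

theorem evalOne_one : R.evalOne 1 ≠ 0 := fun h => by
  have h1 := DFunLike.congr_fun h 1
  rw [evalOne_apply, MonoidAlgebra.coeff_one_one, Module.End.one_apply] at h1
  simpa using congrArg (Nichols.counit R.braiding) h1

theorem evalOne_mul_opYstar (p : R.Op) (s : Refl G) : R.evalOne (p * R.opYstar s) = 0 := by
  ext g
  rw [evalOne_apply, opYstar, MonoidAlgebra.coeff_mul_single_apply, Module.End.mul_apply,
    (R.isSkewDerivation_deriv s).map_one, map_zero, Finsupp.zero_apply]

theorem eq_zero_of_opDeriv_eq_zero (p : R.Op) (h1 : R.evalOne p = 0)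
    (h : ∀ s, R.opDeriv s p = 0) : p = 0 := by
  ext g b
  have hb : b ∈ LinearMap.ker (p.coeff g) := by
    refine mem_of_mul_right_mem (DFunLike.congr_fun h1 g) ?_ (Nichols.mem_adjoin_range_gen b)
    rintro b hb _ ⟨s, rfl⟩
    have hs := DFunLike.congr_fun (R.coeff_opDeriv s p g) b
    rw [h, LinearMap.sub_apply, LinearMap.smul_apply, Module.End.mul_apply, Module.End.mul_apply,
      LinearMap.mem_ker.1 hb, map_zero, smul_zero, sub_zero] at hs
    exact hs.symm
  exact hb

/-- The operators by which the generators of the braided Heisenberg double act. -/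
def opGen : HeisGen G → R.Op
  | .y s => R.opY s
  | .grp g => R.opGrp g
  | .ystar s => R.opYstar s

theorem wordSum_opY_eq_zero {n : ℕ} {a : (Fin n → Refl G) → ℂ}
    (h : braidedFactorial R.braiding n *ᵥ a = 0) : wordSum R.opY a = 0 := by
  have hmul : wordSum (fun s => Algebra.lmul ℂ _ (Nichols.gen R.braiding s)) a = 0 := by
    rw [← map_wordSum, Nichols.wordSum_gen_eq_zero _ h, map_zero]
  have hsingle := map_wordSum (fun s => Algebra.lmul ℂ _ (Nichols.gen R.braiding s))
    (MonoidAlgebra.singleOneAlgHom (R := ℂ) (M := G)) a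
  rw [hmul, map_zero] at hsingle
  exact hsingle.symm

theorem wordSum_opYstar_eq_zero {n : ℕ} {a : (Fin n → Refl G) → ℂ}
    (h : braidedFactorial R.braidingᵀ n *ᵥ a = 0) : wordSum R.opYstar a = 0 :=
  R.isBraidedDerivation_opDeriv.wordSum_eq_zero R.evalOne_mul_opYstar R.eq_zero_of_opDeriv_eq_zero h

/-- The representation of the braided Heisenberg double. -/
def opRep : HeisDouble R →ₐ[ℂ] R.Op :=
  RingQuot.liftAlgHom ℂ ⟨FreeAlgebra.lift ℂ R.opGen, fun p q hpq => by
    induction hpq with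
    | ker n a h =>
      rw [map_wordSum (B := R.Op), map_zero]
      simpa only [FreeAlgebra.lift_ι_apply, opGen] using R.wordSum_opY_eq_zero h
    | ker_star n a h =>
      rw [map_wordSum (B := R.Op), map_zero]
      simpa only [FreeAlgebra.lift_ι_apply, opGen] using R.wordSum_opYstar_eq_zero h
    | grp_one => simp [opGen]
    | grp_mul g h => simp [opGen]
    | grp_y g s => simpa [opGen] using R.opGrp_mul_opY g s
    | grp_ystar g s => simpa [opGen] using R.opGrp_mul_opYstar g s
    | comm r s => simpa [apply_ite, opGen] using R.opYstar_mul_opY_sub r s⟩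

@[simp]
theorem opRep_y (s : Refl G) : R.opRep (HeisDouble.y R s) = R.opY s := by
  simp [opRep, opGen, HeisDouble.y]

@[simp]
theorem opRep_grp (g : G) : R.opRep (HeisDouble.grp R g) = R.opGrp g := by
  simp [opRep, opGen, HeisDouble.grp]

@[simp]
theorem opRep_ystar (s : Refl G) : R.opRep (HeisDouble.ystar R s) = R.opYstar s := by
  simp [opRep, opGen, HeisDouble.ystar]

end RootData

end Operators

/-! ### Coinvariant algebras in the Nichols algebras -/

section Embeddings

variable {V : Type*} [AddCommGroup V] [Module ℂ V]
  {G : Subgroup (LinearMap.GeneralLinearGroup ℂ V)} (R : RootData G)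

namespace RootData

theorem root_conj (g : G) (s : Refl G) (v : V) :
    R.root (s.conj g) (natRep G g v) = R.cocycle g s * R.root s v := by
  have hconj : natRep G (s.conj g).1 (natRep G g v) = natRep G g (natRep G s.1 v) := by
    rw [← Module.End.mul_apply, ← Module.End.mul_apply, ← map_mul, ← map_mul, Refl.conj_val_mul]
  rw [R.apply_eq, R.apply_eq, map_sub, map_smul, R.cocycle_spec, sub_right_inj, smul_smul,
    mul_comm] at hconj
  exact smul_left_injective ℂ (R.coroot_ne_zero (s.conj g)) hconj

theorem dual_coroot_conj (g : G) (s : Refl G) (f : Module.Dual ℂ V) :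
    (natRep G).dual g f (R.coroot (s.conj g)) = (R.cocycle g s)⁻¹ * f (R.coroot s) := by
  rw [eq_inv_mul_iff_mul_eq₀ (R.cocycle_ne_zero g s), ← smul_eq_mul, ← map_smul, ← R.cocycle_spec,
    Representation.dual_apply, Module.Dual.transpose_apply, LinearMap.comp_apply,
    ← Module.End.mul_apply, ← map_mul, inv_mul_cancel, map_one, Module.End.one_apply]

theorem dual_apply_eq (s : Refl G) (f : Module.Dual ℂ V) :
    (natRep G).dual s.1 f = f - f (R.coroot s) • -(natRep G).dual s.1 (R.root s) := by
  ext v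
  have hv : natRep G s.1 (natRep G s.1⁻¹ v) = v := by
    rw [← Module.End.mul_apply, ← map_mul, mul_inv_cancel, map_one, Module.End.one_apply]
  have hf := congrArg f (R.apply_eq s (natRep G s.1⁻¹ v))
  rw [hv, map_sub, map_smul, smul_eq_mul] at hf
  simp only [Representation.dual_apply, Module.Dual.transpose_apply, LinearMap.comp_apply,
    LinearMap.sub_apply, LinearMap.smul_apply, LinearMap.neg_apply, smul_eq_mul]
  rw [hf]
  ring

/-- The reflections of `V`. -/
def family : ReflectionFamily (natRep G) (Refl G) where
  elt s := s.1
  root := R.root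
  coroot := R.coroot
  apply_eq := R.apply_eq
  coroot_ne_zero := R.coroot_ne_zero

/-- The reflections of `V*`: roots and coroots change places, up to a twist by the action. -/
def dualFamily : ReflectionFamily (natRep G).dual (Refl G) where
  elt s := s.1
  root s := Module.Dual.eval ℂ V (R.coroot s)
  coroot s := -(natRep G).dual s.1 (R.root s)
  apply_eq := R.dual_apply_eq
  coroot_ne_zero s h := R.root_ne_zero s <| by
    have h1 := congrArg ((natRep G).dual s.1⁻¹) (neg_eq_zero.1 h)
    rwa [map_zero, ← Module.End.mul_apply, ← map_mul, inv_mul_cancel, map_one,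
      Module.End.one_apply] at h1

variable [Finite G]

section Sums

variable {M N : Type*} [AddCommGroup M] [Module ℂ M] [AddCommGroup N] [Module ℂ N]

/-- The linear map `v ↦ ∑ c_s ⟨α_s, v⟩ x_s`. -/
def rootSum (c : Refl G → ℂ) (x : Refl G → M) : V →ₗ[ℂ] M :=
  ∑ s, (c s • R.root s).smulRight (x s)

/-- The linear map `f ↦ ∑ ⟨f, α̌_s⟩ x_s`. -/
def corootSum (x : Refl G → M) : Module.Dual ℂ V →ₗ[ℂ] M :=
  ∑ s, (Module.Dual.eval ℂ V (R.coroot s)).smulRight (x s)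

theorem rootSum_apply (c : Refl G → ℂ) (x : Refl G → M) (v : V) :
    R.rootSum c x v = ∑ s, (c s * R.root s v) • x s := by
  simp [rootSum]

theorem corootSum_apply (x : Refl G → M) (f : Module.Dual ℂ V) :
    R.corootSum x f = ∑ s, f (R.coroot s) • x s := by
  simp [corootSum]

theorem map_rootSum {F : Type*} [FunLike F M N] [LinearMapClass F ℂ M N] (φ : F)
    (c : Refl G → ℂ) (x : Refl G → M) (v : V) :
    φ (R.rootSum c x v) = R.rootSum c (fun s => φ (x s)) v := by
  simp [rootSum_apply]

theorem map_corootSum {F : Type*} [FunLike F M N] [LinearMapClass F ℂ M N] (φ : F)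
    (x : Refl G → M) (f : Module.Dual ℂ V) :
    φ (R.corootSum x f) = R.corootSum (fun s => φ (x s)) f := by
  simp [corootSum_apply]

theorem rootSum_cocycle {c : Refl G → ℂ} (hc : ∀ g s, c (s.conj g) = c s) (g : G)
    (x : Refl G → M) (v : V) :
    R.rootSum c (fun s => R.cocycle g s • x (s.conj g)) v = R.rootSum c x (natRep G g v) := by
  rw [rootSum_apply, rootSum_apply]
  refine .trans ?_ ((Refl.conj_injective g).bijective_of_finite.sum_comp _)
  refine Finset.sum_congr rfl fun s _ => ?_
  rw [hc, root_conj, smul_smul, mul_right_comm, mul_assoc]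

theorem corootSum_cocycle (g : G) (x : Refl G → M) (f : Module.Dual ℂ V) :
    R.corootSum (fun s => (R.cocycle g s)⁻¹ • x (s.conj g)) f
      = R.corootSum x ((natRep G).dual g f) := by
  rw [corootSum_apply, corootSum_apply]
  refine .trans ?_ ((Refl.conj_injective g).bijective_of_finite.sum_comp _)
  refine Finset.sum_congr rfl fun s _ => ?_
  rw [dual_coroot_conj, smul_smul, mul_comm]

end Sums

/-- The divided differences on `S(V)`, realised by the braided derivatives of `B(Y_G)`. -/
def realization {c : Refl G → ℂ} (hc : ∀ g s, c (s.conj g) = c s) :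
    DividedDiffRealization R.family c (Nichols R.braiding) ℂ where
  θ s := R.act s.1
  D := R.deriv
  ε := (Nichols.counit R.braiding).toLinearMap
  val := R.rootSum c (Nichols.gen R.braiding)
  isSkewDerivation := R.isSkewDerivation_deriv
  D_val s u := by
    rw [rootSum_apply, map_sum]
    simp [deriv_gen, Algebra.algebraMap_eq_smul_one, family]
  θ_val s u := by
    rw [map_rootSum]
    simp only [act_gen]
    exact R.rootSum_cocycle hc s.1 _ u
  ε_one := by simp
  ε_mul_val p u := by simp [rootSum_apply, Nichols.counit_gen]
  eq_zero p := R.eq_zero_of_deriv_eq_zero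

/-- The homomorphism by which `B(Y_G*)` acts on `B(Y_G)`. -/
def opDual : Nichols R.braidingᵀ →ₐ[ℂ] R.Op :=
  Nichols.lift fun _ _ => R.wordSum_opYstar_eq_zero

@[simp]
theorem opDual_gen (s : Refl G) : R.opDual (Nichols.gen _ s) = R.opYstar s := Nichols.lift_gen _ s

theorem opDual_injective : Function.Injective R.opDual :=
  Nichols.lift_injective _ R.isBraidedDerivation_opDeriv R.evalOne_one R.evalOne_mul_opYstar

/-- The twisted commutator with `[s]`. -/
def opComm (s : Refl G) : R.Op →ₗ[ℂ] R.Op :=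
  twistedComm (R.opGrp.toHomUnits s.1) (R.opY s)

theorem opComm_opYstar (s r : Refl G) : R.opComm s (R.opYstar r) = if s = r then 1 else 0 := by
  rw [opComm, twistedComm_apply, opYstar_mul_opY_sub]
  split_ifs with hrs hsr hsr
  · exact (R.opGrp.toHomUnits s.1).mul_inv
  · exact absurd hrs.symm hsr
  · exact absurd hsr.symm hrs
  · exact zero_mul _

theorem conj_opYstar (s r : Refl G) :
    MulSemiringAction.toAlgHom ℂ R.Op (ConjAct.toConjAct (R.opGrp.toHomUnits s.1)) (R.opYstar r)
      = (R.cocycle s.1 r)⁻¹ • R.opYstar (r.conj s.1) := by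
  rw [MulSemiringAction.toAlgHom_apply, ConjAct.units_smul_def, ConjAct.ofConjAct_toConjAct,
    MonoidHom.coe_toHomUnits, opGrp_mul_opYstar, smul_mul_assoc, ← MonoidHom.coe_toHomUnits,
    Units.mul_inv_cancel_right]

theorem eq_zero_of_opComm_eq_zero (p : R.Op) (h1 : R.evalOne p = 0)
    (h : ∀ s, R.opComm s p = 0) : p = 0 := by
  ext g b
  have hb : b ∈ LinearMap.ker (p.coeff g) := by
    refine mem_of_mul_left_mem (DFunLike.congr_fun h1 g) ?_ (Nichols.mem_adjoin_range_gen b)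
    rintro _ ⟨s, rfl⟩ b hb
    have hcomm : p * R.opY s = R.opY s * p :=
      sub_eq_zero.1 ((Units.mul_left_eq_zero _).1 (h s))
    have hs := DFunLike.congr_fun (congrArg (fun q => q.coeff g) hcomm) b
    rw [opY, MonoidAlgebra.coeff_mul_single_one, MonoidAlgebra.coeff_single_one_mul,
      Module.End.mul_apply, Module.End.mul_apply, LinearMap.mulLeft_apply, LinearMap.mulLeft_apply,
      LinearMap.mem_ker.1 hb, mul_zero] at hs
    exact hs
  exact hb

/-- The divided differences on `S(V*)`, realised by the twisted commutators with the `[s]`. -/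
def dualRealization :
    DividedDiffRealization R.dualFamily 1 R.Op (G →₀ Nichols R.braiding) where
  θ s := MulSemiringAction.toAlgHom ℂ R.Op (ConjAct.toConjAct (R.opGrp.toHomUnits s.1))
  D := R.opComm
  ε := R.evalOne
  val := R.corootSum R.opYstar
  isSkewDerivation s := isSkewDerivation_twistedComm _ _
  D_val s u := by
    rw [corootSum_apply, map_sum]
    simp [opComm_opYstar, Algebra.algebraMap_eq_smul_one, dualFamily]
  θ_val s u := by
    rw [map_corootSum]
    simp only [conj_opYstar]
    exact R.corootSum_cocycle s.1 R.opYstar u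
  ε_one := R.evalOne_one
  ε_mul_val p u := by simp [corootSum_apply, Finset.mul_sum, evalOne_mul_opYstar]
  eq_zero := R.eq_zero_of_opComm_eq_zero

end RootData

end Embeddings

/-! ### The homomorphism into the braided Heisenberg double -/

section Homomorphism

variable {V : Type*} [AddCommGroup V] [Module ℂ V]
  {G : Subgroup (LinearMap.GeneralLinearGroup ℂ V)} [Finite G]

namespace HeisDouble

variable (R : RootData G)

theorem grp_one : grp R 1 = 1 := by
  simpa [grp] using RingQuot.mkAlgHom_rel ℂ (HeisRel.grp_one (R := R))

theorem grp_mul (g h : G) : grp R (g * h) = grp R g * grp R h := by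
  simpa [grp] using RingQuot.mkAlgHom_rel ℂ (HeisRel.grp_mul (R := R) g h)

theorem grp_mul_y (g : G) (s : Refl G) :
    grp R g * y R s = R.cocycle g s • (y R (s.conj g) * grp R g) := by
  simpa [grp, y] using RingQuot.mkAlgHom_rel ℂ (HeisRel.grp_y (R := R) g s)

theorem grp_mul_ystar (g : G) (s : Refl G) :
    grp R g * ystar R s = (R.cocycle g s)⁻¹ • (ystar R (s.conj g) * grp R g) := by
  simpa [grp, ystar] using RingQuot.mkAlgHom_rel ℂ (HeisRel.grp_ystar (R := R) g s)

theorem ystar_mul_y_sub (r s : Refl G) :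
    ystar R r * y R s - y R s * ystar R r = if r = s then grp R s.1 else 0 := by
  simpa [grp, y, ystar, apply_ite] using RingQuot.mkAlgHom_rel ℂ (HeisRel.comm (R := R) r s)

/-- The homomorphism from `B(Y_G)`. -/
def ofNichols : Nichols R.braiding →ₐ[ℂ] HeisDouble R :=
  Nichols.lift (x := y R) fun n a h => by
    have hrel := RingQuot.mkAlgHom_rel ℂ (HeisRel.ker (R := R) n a h)
    rwa [map_zero, map_wordSum] at hrel

@[simp]
theorem ofNichols_gen (s : Refl G) : ofNichols R (Nichols.gen _ s) = y R s := Nichols.lift_gen _ s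

/-- The homomorphism from `B(Y_G*)`. -/
def ofNicholsDual : Nichols R.braidingᵀ →ₐ[ℂ] HeisDouble R :=
  Nichols.lift (x := ystar R) fun n a h => by
    have hrel := RingQuot.mkAlgHom_rel ℂ (HeisRel.ker_star (R := R) n a h)
    rwa [map_zero, map_wordSum] at hrel

@[simp]
theorem ofNicholsDual_gen (s : Refl G) : ofNicholsDual R (Nichols.gen _ s) = ystar R s :=
  Nichols.lift_gen _ s

end HeisDouble

namespace RootData

variable (R : RootData G)

variable {c : Refl G → ℂ}

/-- The embedding of the coinvariant algebra of `V` in `B(Y_G)`. -/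
def coinvariantHom (hc : ∀ g s, c (s.conj g) = c s) :
    Coinvariant (natRep G) →ₐ[ℂ] Nichols R.braiding :=
  (R.realization hc).coinvariantHom

theorem coinvariantHom_ι (hc : ∀ g s, c (s.conj g) = c s) (v : V) :
    R.coinvariantHom hc (Ideal.Quotient.mk _ (SymmetricAlgebra.ι ℂ V v))
      = R.rootSum c (Nichols.gen R.braiding) v :=
  (R.realization hc).toHom_ι v

theorem coinvariantHom_injective (hc : ∀ g s, c (s.conj g) = c s)
    (hc' : Subgroup.closure {g : G | ∃ s : Refl G, s.1 = g ∧ c s ≠ 0} = ⊤) :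
    Function.Injective (R.coinvariantHom hc) := by
  refine (R.realization hc).coinvariantHom_injective ?_
  convert hc' using 2
  ext g
  simp [family, and_comm]

theorem opDual_corootSum (f : Module.Dual ℂ V) :
    R.opDual (R.corootSum (Nichols.gen R.braidingᵀ) f) = R.corootSum R.opYstar f := by
  simp only [map_corootSum, opDual_gen]

/-- The homomorphism `S(V*) → B(Y_G*)` that sends `f` to `∑ ⟨f, α̌_s⟩ [s]*`. -/
def dualSymHom : SymmetricAlgebra ℂ (Module.Dual ℂ V) →ₐ[ℂ] Nichols R.braidingᵀ :=
  symLift (R.corootSum (Nichols.gen R.braidingᵀ)) fun f f' => R.opDual_injective <| by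
    simp only [map_mul, opDual_corootSum]
    exact R.dualRealization.commute_val f f'

theorem dualSymHom_ι (f : Module.Dual ℂ V) : R.dualSymHom (SymmetricAlgebra.ι ℂ _ f)
    = R.corootSum (Nichols.gen R.braidingᵀ) f :=
  symLift_ι _ _ f

theorem opDual_dualSymHom (p : SymmetricAlgebra ℂ (Module.Dual ℂ V)) :
    R.opDual (R.dualSymHom p) = R.dualRealization.toHom p := by
  induction p using SymmetricAlgebra.induction with
  | algebraMap z => simp only [AlgHom.commutes]
  | ι f => rw [dualSymHom_ι, opDual_corootSum]; exact (R.dualRealization.toHom_ι f).symm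
  | mul p q hp hq => rw [map_mul, map_mul, map_mul, hp, hq]
  | add p q hp hq => rw [map_add, map_add, map_add, hp, hq]

/-- The embedding of the coinvariant algebra of `V*` in `B(Y_G*)`. -/
def dualCoinvariantHom : Coinvariant (natRep G).dual →ₐ[ℂ] Nichols R.braidingᵀ :=
  Ideal.Quotient.liftₐ _ R.dualSymHom fun p hp => R.opDual_injective <| by
    rw [opDual_dualSymHom, map_zero, R.dualRealization.toHom_eq_zero_of_mem hp]

theorem dualCoinvariantHom_ι (f : Module.Dual ℂ V) :
    R.dualCoinvariantHom (Ideal.Quotient.mk _ (SymmetricAlgebra.ι ℂ _ f))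
      = R.corootSum (Nichols.gen R.braidingᵀ) f :=
  R.dualSymHom_ι f

theorem dualCoinvariantHom_injective
    (h : Subgroup.closure {g : G | IsReflection g} = ⊤) :
    Function.Injective R.dualCoinvariantHom := by
  refine (injective_iff_map_eq_zero _).2 fun q hq => ?_
  obtain ⟨p, rfl⟩ := Ideal.Quotient.mk_surjective q
  refine Ideal.Quotient.eq_zero_iff_mem.2 (R.dualRealization.mem_of_toHom_eq_zero ?_ ?_)
  · convert h using 2
    ext g
    exact ⟨fun ⟨s, _, hs⟩ => hs ▸ s.2, fun hg => ⟨⟨g, hg⟩, one_ne_zero, rfl⟩⟩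
  · rw [← opDual_dualSymHom]
    exact (congrArg R.opDual hq).trans (map_zero _)

/-- The image of `V` in the braided Heisenberg double. -/
def heisVec (hc : ∀ g s, c (s.conj g) = c s) : Coinvariant (natRep G) →ₐ[ℂ] HeisDouble R :=
  (HeisDouble.ofNichols R).comp (R.coinvariantHom hc)

theorem heisVec_ι (hc : ∀ g s, c (s.conj g) = c s) (v : V) :
    R.heisVec hc (Ideal.Quotient.mk _ (SymmetricAlgebra.ι ℂ V v))
      = R.rootSum c (HeisDouble.y R) v := by
  simp only [heisVec, AlgHom.comp_apply, coinvariantHom_ι, map_rootSum, HeisDouble.ofNichols_gen]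

/-- The image of `V*` in the braided Heisenberg double. -/
def heisCov : Coinvariant (natRep G).dual →ₐ[ℂ] HeisDouble R :=
  (HeisDouble.ofNicholsDual R).comp R.dualCoinvariantHom

theorem heisCov_ι (f : Module.Dual ℂ V) :
    R.heisCov (Ideal.Quotient.mk _ (SymmetricAlgebra.ι ℂ _ f))
      = R.corootSum (HeisDouble.ystar R) f := by
  simp only [heisCov, AlgHom.comp_apply, dualCoinvariantHom_ι, map_corootSum,
    HeisDouble.ofNicholsDual_gen]

theorem grp_mul_rootSum (hc : ∀ g s, c (s.conj g) = c s) (g : G) (v : V) :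
    HeisDouble.grp R g * R.rootSum c (HeisDouble.y R) v
      = R.rootSum c (HeisDouble.y R) (natRep G g v) * HeisDouble.grp R g := by
  rw [← R.rootSum_cocycle hc, rootSum_apply, rootSum_apply, Finset.mul_sum, Finset.sum_mul]
  simp only [mul_smul_comm, smul_mul_assoc, HeisDouble.grp_mul_y]

theorem grp_mul_corootSum (g : G) (f : Module.Dual ℂ V) :
    HeisDouble.grp R g * R.corootSum (HeisDouble.ystar R) f
      = R.corootSum (HeisDouble.ystar R) ((natRep G).dual g f) * HeisDouble.grp R g := by
  rw [← R.corootSum_cocycle, corootSum_apply, corootSum_apply, Finset.mul_sum, Finset.sum_mul]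
  simp only [mul_smul_comm, smul_mul_assoc, HeisDouble.grp_mul_ystar]

omit [Finite G] in
theorem apply_sub_natRep (f : Module.Dual ℂ V) (s : Refl G) (v : V) :
    f (v - natRep G s.1 v) = f (R.coroot s) * R.root s v := by
  rw [R.apply_eq, sub_sub_cancel, map_smul, smul_eq_mul, mul_comm]

theorem corootSum_mul_rootSum_sub (f : Module.Dual ℂ V) (v : V) :
    R.corootSum (HeisDouble.ystar R) f * R.rootSum c (HeisDouble.y R) v
        - R.rootSum c (HeisDouble.y R) v * R.corootSum (HeisDouble.ystar R) f
      = ∑ s : Refl G, (c s * f (v - natRep G s.1 v)) • HeisDouble.grp R s.1 := by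
  rw [corootSum_apply, rootSum_apply, Finset.sum_mul_sum, Finset.sum_mul_sum, Finset.sum_comm,
    ← Finset.sum_sub_distrib]
  refine Finset.sum_congr rfl fun s _ => ?_
  rw [← Finset.sum_sub_distrib]
  simp only [smul_mul_smul_comm, mul_comm (c s * R.root s v), ← smul_sub,
    HeisDouble.ystar_mul_y_sub, smul_ite, smul_zero, Finset.sum_ite_eq', Finset.mem_univ, if_true]
  rw [apply_sub_natRep, mul_left_comm]

theorem commute_rootSum (hc : ∀ g s, c (s.conj g) = c s) (v w : V) :
    Commute (R.rootSum c (HeisDouble.y R) v) (R.rootSum c (HeisDouble.y R) w) := by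
  rw [← R.heisVec_ι hc, ← R.heisVec_ι hc]
  exact (Commute.all _ _).map (R.heisVec hc)

theorem commute_corootSum (f f' : Module.Dual ℂ V) :
    Commute (R.corootSum (HeisDouble.ystar R) f) (R.corootSum (HeisDouble.ystar R) f') := by
  rw [← R.heisCov_ι, ← R.heisCov_ι]
  exact (Commute.all _ _).map R.heisCov

/-- The images of the generators of the Cherednik algebra in the braided Heisenberg double. -/
def heisGen (c : Refl G → ℂ) : CherGen G → HeisDouble R
  | .vec v => R.rootSum c (HeisDouble.y R) v
  | .grp g => HeisDouble.grp R g
  | .cov f => R.corootSum (HeisDouble.ystar R) f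

/-- The homomorphism `M_c` before the passage to the restricted Cherednik algebra. -/
def ratCherHom (hc : ∀ g s, c (s.conj g) = c s) : RatCher 0 c →ₐ[ℂ] HeisDouble R :=
  RingQuot.liftAlgHom ℂ ⟨FreeAlgebra.lift ℂ (R.heisGen c), fun p q hpq => by
    induction hpq with
    | vec_add v w => simp [heisGen]
    | vec_smul z v => simp [heisGen]
    | cov_add f f' => simp [heisGen]
    | cov_smul z f => simp [heisGen]
    | grp_one => simp [heisGen, HeisDouble.grp_one]
    | grp_mul g h => simp [heisGen, HeisDouble.grp_mul]
    | vec_comm v w => simpa [heisGen] using (R.commute_rootSum hc v w).eq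
    | cov_comm f f' => simpa [heisGen] using (R.commute_corootSum f f').eq
    | grp_vec g v => simpa [heisGen] using R.grp_mul_rootSum hc g v
    | grp_cov g f => simpa [heisGen] using R.grp_mul_corootSum g f
    | cov_vec f v => simpa [heisGen] using R.corootSum_mul_rootSum_sub f v⟩

theorem ratCherHom_vec (hc : ∀ g s, c (s.conj g) = c s) (v : V) :
    R.ratCherHom hc (RatCher.vec 0 c v) = R.rootSum c (HeisDouble.y R) v := by
  simp [ratCherHom, heisGen, RatCher.vec]

theorem ratCherHom_cov (hc : ∀ g s, c (s.conj g) = c s) (f : Module.Dual ℂ V) :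
    R.ratCherHom hc (RatCher.cov 0 c f) = R.corootSum (HeisDouble.ystar R) f := by
  simp [ratCherHom, heisGen, RatCher.cov]

theorem ratCherHom_grp (hc : ∀ g s, c (s.conj g) = c s) (g : G) :
    R.ratCherHom hc (RatCher.grp 0 c g) = HeisDouble.grp R g := by
  simp [ratCherHom, heisGen, RatCher.grp]

theorem ratCherHom_lift_vec (hc : ∀ g s, c (s.conj g) = c s) (x : TensorAlgebra ℂ V) :
    R.ratCherHom hc (TensorAlgebra.lift ℂ (RatCher.vec 0 c) x)
      = R.heisVec hc (Ideal.Quotient.mk _ (SymmetricAlgebra.algHom ℂ V x)) := by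
  have hcomp : (R.ratCherHom hc).comp (TensorAlgebra.lift ℂ (RatCher.vec 0 c))
      = ((R.heisVec hc).comp (Ideal.Quotient.mkₐ ℂ _)).comp (SymmetricAlgebra.algHom ℂ V) := by
    refine TensorAlgebra.hom_ext (LinearMap.ext fun v => ?_)
    refine (congrArg (R.ratCherHom hc) (TensorAlgebra.lift_ι_apply _ v)).trans ?_
    exact (R.ratCherHom_vec hc v).trans (R.heisVec_ι hc v).symm
  exact DFunLike.congr_fun hcomp x

theorem ratCherHom_lift_cov (hc : ∀ g s, c (s.conj g) = c s)
    (x : TensorAlgebra ℂ (Module.Dual ℂ V)) :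
    R.ratCherHom hc (TensorAlgebra.lift ℂ (RatCher.cov 0 c) x)
      = R.heisCov (Ideal.Quotient.mk _ (SymmetricAlgebra.algHom ℂ _ x)) := by
  have hcomp : (R.ratCherHom hc).comp (TensorAlgebra.lift ℂ (RatCher.cov 0 c))
      = (R.heisCov.comp (Ideal.Quotient.mkₐ ℂ _)).comp (SymmetricAlgebra.algHom ℂ _) := by
    refine TensorAlgebra.hom_ext (LinearMap.ext fun f => ?_)
    refine (congrArg (R.ratCherHom hc) (TensorAlgebra.lift_ι_apply _ f)).trans ?_
    exact (R.ratCherHom_cov hc f).trans (R.heisCov_ι f).symm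
  exact DFunLike.congr_fun hcomp x

/-- The homomorphism `M_c`. -/
def restrCherHom (hc : ∀ g s, c (s.conj g) = c s) : RestrCher c →ₐ[ℂ] HeisDouble R :=
  RingQuot.liftAlgHom ℂ ⟨R.ratCherHom hc, fun p q hpq => by
    induction hpq with
    | vec x hx =>
      rw [ratCherHom_lift_vec, Ideal.Quotient.eq_zero_iff_mem.2 (Ideal.subset_span hx), map_zero,
        map_zero]
    | cov x hx =>
      rw [ratCherHom_lift_cov, Ideal.Quotient.eq_zero_iff_mem.2 (Ideal.subset_span hx), map_zero,
        map_zero]⟩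

theorem restrCherHom_vec (hc : ∀ g s, c (s.conj g) = c s) (v : V) :
    R.restrCherHom hc (RestrCher.vec c v) = R.rootSum c (HeisDouble.y R) v := by
  rw [restrCherHom, RestrCher.vec, RingQuot.liftAlgHom_mkAlgHom_apply, ratCherHom_vec]

theorem restrCherHom_cov (hc : ∀ g s, c (s.conj g) = c s) (f : Module.Dual ℂ V) :
    R.restrCherHom hc (RestrCher.cov c f) = R.corootSum (HeisDouble.ystar R) f := by
  rw [restrCherHom, RestrCher.cov, RingQuot.liftAlgHom_mkAlgHom_apply, ratCherHom_cov]

theorem restrCherHom_grp (hc : ∀ g s, c (s.conj g) = c s) (g : G) :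
    R.restrCherHom hc (RestrCher.grp c g) = HeisDouble.grp R g := by
  rw [restrCherHom, RestrCher.grp, RingQuot.liftAlgHom_mkAlgHom_apply, ratCherHom_grp]

end RootData

end Homomorphism

/-! ### Injectivity on the restricted Cherednik algebra -/

section Straightening

variable {K A : Type*} [CommRing K] [Ring A] [Algebra K A] {s u : Set A}

section

variable (h : ∀ y ∈ u, ∀ x ∈ s,
  y * x ∈ Subalgebra.toSubmodule (Algebra.adjoin K s) * (1 ⊔ Submodule.span K u))
include h

theorem mul_mem_adjoin_mul_one_sup_span {t : A} (ht : t ∈ Algebra.adjoin K s) :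
    ∀ y ∈ u, y * t ∈ Subalgebra.toSubmodule (Algebra.adjoin K s) * (1 ⊔ Submodule.span K u) := by
  set T := Subalgebra.toSubmodule (Algebra.adjoin K s)
  set W : Submodule K A := 1 ⊔ Submodule.span K u
  have hW : 1 ∈ W := Submodule.mem_sup_left (Submodule.one_le.1 le_rfl)
  have huW : Submodule.span K u ≤ W := le_sup_right
  induction ht using Algebra.adjoin_induction with
  | mem x hx => exact fun y hy => h y hy x hx
  | algebraMap z =>
    intro y hy
    rw [← Algebra.commutes]
    exact Submodule.mul_mem_mul (Subalgebra.algebraMap_mem _ z) (huW (Submodule.subset_span hy))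
  | add p q _ _ hp hq =>
    intro y hy
    rw [mul_add]
    exact add_mem (hp y hy) (hq y hy)
  | mul p q _ hqT hp hq =>
    intro y hy
    have hWq : W ≤ (T * W).comap (LinearMap.mulRight K q) := by
      refine sup_le ?_ (Submodule.span_le.2 hq)
      rw [Submodule.one_le, Submodule.mem_comap, LinearMap.mulRight_apply, one_mul]
      simpa only [mul_one] using Submodule.mul_mem_mul hqT hW
    rw [← mul_assoc]
    refine Submodule.mul_induction_on (hp y hy) (fun t ht w hw => ?_) fun v w hv hw => ?_
    · rw [mul_assoc, ← (show T * T = T from Subalgebra.isIdempotentElem_toSubmodule _), mul_assoc]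
      exact Submodule.mul_mem_mul ht (hWq hw)
    · rw [add_mul]
      exact add_mem hv hw

theorem adjoin_union_le_mul :
    Subalgebra.toSubmodule (Algebra.adjoin K (s ∪ u)) ≤
      Subalgebra.toSubmodule (Algebra.adjoin K s) *
        Subalgebra.toSubmodule (Algebra.adjoin K u) := by
  set T := Subalgebra.toSubmodule (Algebra.adjoin K s)
  set C := Subalgebra.toSubmodule (Algebra.adjoin K u)
  have hT : T * T = T := Subalgebra.isIdempotentElem_toSubmodule _
  have hC : C * C = C := Subalgebra.isIdempotentElem_toSubmodule _
  have hWC : 1 ⊔ Submodule.span K u ≤ C :=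
    sup_le (Submodule.one_le.2 (one_mem (Algebra.adjoin K u))) (Algebra.span_le_adjoin K u)
  refine fun p hp => mem_of_mul_left_mem ?_ ?_ hp
  · exact Submodule.one_le.1 ((one_mul (1 : Submodule K A)).symm.le.trans
      (mul_le_mul' (Submodule.one_le.2 (one_mem (Algebra.adjoin K s)))
        (Submodule.one_le.2 (one_mem (Algebra.adjoin K u)))))
  rintro x (hx | hx) q hq
  · rw [← hT, mul_assoc]
    exact Submodule.mul_mem_mul (Algebra.subset_adjoin hx) hq
  · refine Submodule.mul_induction_on hq (fun t ht w hw => ?_) fun v w hv hw => ?_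
    · rw [← mul_assoc, ← hC, ← mul_assoc]
      exact Submodule.mul_mem_mul
        (mul_le_mul_right hWC T (mul_mem_adjoin_mul_one_sup_span h ht x hx)) hw
    · rw [mul_add]
      exact add_mem hv hw

end

end Straightening

theorem toSubmodule_adjoin_range_monoidHom {K A M : Type*} [CommSemiring K] [Semiring A]
    [Algebra K A] [Monoid M] (φ : M →* A) :
    Subalgebra.toSubmodule (Algebra.adjoin K (Set.range φ)) = Submodule.span K (Set.range φ) := by
  rw [Algebra.adjoin_eq_span, ← MonoidHom.coe_mrange, Submonoid.closure_eq]

section Injectivity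

variable {V : Type*} [AddCommGroup V] [Module ℂ V]
  {G : Subgroup (LinearMap.GeneralLinearGroup ℂ V)} [Finite G]

open scoped TensorProduct

namespace RatCher

variable (c : Refl G → ℂ)

/-- The homomorphism `S(V) → H_{0,c}(G)`. -/
def symVec : SymmetricAlgebra ℂ V →ₐ[ℂ] RatCher 0 c :=
  symLift (vec 0 c) fun v w => by
    simpa [vec, Commute, SemiconjBy] using
      RingQuot.mkAlgHom_rel ℂ (CherRel.vec_comm (t := 0) (c := c) v w)

theorem symVec_ι (v : V) : symVec c (SymmetricAlgebra.ι ℂ V v) = vec 0 c v := symLift_ι _ _ v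

/-- The homomorphism `S(V*) → H_{0,c}(G)`. -/
def symCov : SymmetricAlgebra ℂ (Module.Dual ℂ V) →ₐ[ℂ] RatCher 0 c :=
  symLift (cov 0 c) fun f f' => by
    simpa [cov, Commute, SemiconjBy] using
      RingQuot.mkAlgHom_rel ℂ (CherRel.cov_comm (t := 0) (c := c) f f')

theorem symCov_ι (f : Module.Dual ℂ V) :
    symCov c (SymmetricAlgebra.ι ℂ _ f) = cov 0 c f :=
  symLift_ι _ _ f

end RatCher

namespace RestrCher

variable (c : Refl G → ℂ)

/-- The group elements in the restricted Cherednik algebra. -/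
def grpHom : G →* RestrCher c where
  toFun := grp c
  map_one' := by
    have hrel : RatCher.grp 0 c 1 = 1 := by
      simpa [RatCher.grp] using RingQuot.mkAlgHom_rel ℂ (CherRel.grp_one (t := 0) (c := c))
    rw [grp, hrel, map_one]
  map_mul' g h := by
    have hrel : RatCher.grp 0 c (g * h) = RatCher.grp 0 c g * RatCher.grp 0 c h := by
      simpa [RatCher.grp] using RingQuot.mkAlgHom_rel ℂ (CherRel.grp_mul (t := 0) (c := c) g h)
    rw [grp, hrel, map_mul, grp, grp]

theorem grp_mul_vec (g : G) (v : V) : grp c g * vec c v = vec c (natRep G g v) * grp c g := by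
  have hrel : RatCher.grp 0 c g * RatCher.vec 0 c v
      = RatCher.vec 0 c (natRep G g v) * RatCher.grp 0 c g := by
    simpa [RatCher.grp, RatCher.vec] using
      RingQuot.mkAlgHom_rel ℂ (CherRel.grp_vec (t := 0) (c := c) g v)
  rw [grp, vec, vec, ← map_mul, hrel, map_mul]

theorem grp_mul_cov (g : G) (f : Module.Dual ℂ V) :
    grp c g * cov c f = cov c ((natRep G).dual g f) * grp c g := by
  have hrel : RatCher.grp 0 c g * RatCher.cov 0 c f
      = RatCher.cov 0 c ((natRep G).dual g f) * RatCher.grp 0 c g := by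
    simpa [RatCher.grp, RatCher.cov] using
      RingQuot.mkAlgHom_rel ℂ (CherRel.grp_cov (t := 0) (c := c) g f)
  rw [grp, cov, cov, ← map_mul, hrel, map_mul]

theorem cov_mul_grp (f : Module.Dual ℂ V) (g : G) :
    cov c f * grp c g = grp c g * cov c ((natRep G).dual g⁻¹ f) := by
  rw [grp_mul_cov, ← Module.End.mul_apply, ← map_mul, mul_inv_cancel, map_one,
    Module.End.one_apply]

theorem cov_mul_vec (f : Module.Dual ℂ V) (v : V) : cov c f * vec c v
    = vec c v * cov c f + ∑ s : Refl G, (c s * f (v - natRep G s.1 v)) • grp c s.1 := by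
  have hrel : RatCher.cov 0 c f * RatCher.vec 0 c v - RatCher.vec 0 c v * RatCher.cov 0 c f
      = ∑ s : Refl G, (c s * f (v - natRep G s.1 v)) • RatCher.grp 0 c s.1 := by
    simpa [RatCher.grp, RatCher.cov, RatCher.vec] using
      RingQuot.mkAlgHom_rel ℂ (CherRel.cov_vec (t := 0) (c := c) f v)
  rw [cov, vec, ← map_mul, sub_eq_iff_eq_add'.1 hrel, map_add, map_mul, map_sum]
  simp only [map_smul, grp]

theorem adjoin_generators :
    Algebra.adjoin ℂ (Set.range (vec c) ∪ Set.range (grp c) ∪ Set.range (cov c)) = ⊤ := by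
  set φ := (RingQuot.mkAlgHom ℂ (RestrRel c)).comp (RingQuot.mkAlgHom ℂ (CherRel 0 c))
  have hφ : Function.Surjective φ :=
    (RingQuot.mkAlgHom_surjective ℂ _).comp (RingQuot.mkAlgHom_surjective ℂ _)
  rw [← (AlgHom.range_eq_top φ).2 hφ, ← Algebra.map_top, ← FreeAlgebra.adjoin_range_ι,
    AlgHom.map_adjoin]
  refine le_antisymm ?_ ?_
  · rw [← AlgHom.map_adjoin, FreeAlgebra.adjoin_range_ι, Algebra.map_top,
      (AlgHom.range_eq_top φ).2 hφ]
    exact le_top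
  · refine Algebra.adjoin_mono ?_
    rintro _ ⟨_, ⟨v | g | f, rfl⟩, rfl⟩
    exacts [Or.inl (Or.inl ⟨v, rfl⟩), Or.inl (Or.inr ⟨g, rfl⟩), Or.inr ⟨f, rfl⟩]

theorem cov_mul_mem {x : RestrCher c} (hx : x ∈ Set.range (vec c) ∪ Set.range (grp c))
    (f : Module.Dual ℂ V) : cov c f * x ∈
      Subalgebra.toSubmodule (Algebra.adjoin ℂ (Set.range (vec c) ∪ Set.range (grp c)))
        * (1 ⊔ Submodule.span ℂ (Set.range (cov c))) := by
  have hcov (f) : cov c f ∈ 1 ⊔ Submodule.span ℂ (Set.range (cov c)) :=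
    Submodule.mem_sup_right (Submodule.subset_span ⟨f, rfl⟩)
  have hgrp (g) : grp c g ∈ Algebra.adjoin ℂ (Set.range (vec c) ∪ Set.range (grp c)) :=
    Algebra.subset_adjoin (Or.inr ⟨g, rfl⟩)
  obtain ⟨v, rfl⟩ | ⟨g, rfl⟩ := hx
  · rw [cov_mul_vec]
    refine add_mem (Submodule.mul_mem_mul (Algebra.subset_adjoin (Or.inl ⟨v, rfl⟩)) (hcov f))
      (sum_mem fun s _ => Submodule.smul_mem _ _ ?_)
    rw [← mul_one (grp c _)]
    exact Submodule.mul_mem_mul (hgrp _) (Submodule.mem_sup_left (Submodule.one_le.1 le_rfl))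
  · rw [cov_mul_grp]
    exact Submodule.mul_mem_mul (hgrp g) (hcov _)

theorem adjoin_vec_mul_adjoin_grp_mul_adjoin_cov :
    Subalgebra.toSubmodule (Algebra.adjoin ℂ (Set.range (vec c)))
      * Subalgebra.toSubmodule (Algebra.adjoin ℂ (Set.range (grp c)))
      * Subalgebra.toSubmodule (Algebra.adjoin ℂ (Set.range (cov c))) = ⊤ := by
  have hvec : ∀ y ∈ Set.range (grp c), ∀ x ∈ Set.range (vec c), y * x ∈
      Subalgebra.toSubmodule (Algebra.adjoin ℂ (Set.range (vec c)))
        * (1 ⊔ Submodule.span ℂ (Set.range (grp c))) := by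
    rintro _ ⟨g, rfl⟩ _ ⟨v, rfl⟩
    rw [grp_mul_vec]
    exact Submodule.mul_mem_mul (Algebra.subset_adjoin ⟨_, rfl⟩)
      (Submodule.mem_sup_right (Submodule.subset_span ⟨g, rfl⟩))
  have htop := adjoin_union_le_mul (K := ℂ) (u := Set.range (cov c)) fun _ ⟨f, hf⟩ x hx =>
    hf ▸ cov_mul_mem c hx f
  rw [adjoin_generators, Algebra.top_toSubmodule] at htop
  exact top_unique (htop.trans (mul_le_mul' (adjoin_union_le_mul hvec) le_rfl))

/-- The homomorphism `S(V)_G → H̄_{0,c}(G)`. -/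
def vecHom : Coinvariant (natRep G) →ₐ[ℂ] RestrCher c :=
  Ideal.Quotient.liftₐ _ ((RingQuot.mkAlgHom ℂ (RestrRel c)).comp (RatCher.symVec c))
    fun p hp => by
      suffices h : Ideal.span (posInvariants (natRep G)) ≤
          RingHom.ker ((RingQuot.mkAlgHom ℂ (RestrRel c)).comp (RatCher.symVec c)) from h hp
      refine Ideal.span_le.2 fun q hq => ?_
      obtain ⟨x, rfl⟩ := SymmetricAlgebra.algHom_surjective ℂ V q
      exact (RingQuot.mkAlgHom_rel ℂ (RestrRel.vec x hq)).trans (map_zero _)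

/-- The homomorphism `S(V*)_G → H̄_{0,c}(G)`. -/
def covHom : Coinvariant (natRep G).dual →ₐ[ℂ] RestrCher c :=
  Ideal.Quotient.liftₐ _ ((RingQuot.mkAlgHom ℂ (RestrRel c)).comp (RatCher.symCov c))
    fun p hp => by
      suffices h : Ideal.span (posInvariants ((natRep G).dual)) ≤
          RingHom.ker ((RingQuot.mkAlgHom ℂ (RestrRel c)).comp (RatCher.symCov c)) from h hp
      refine Ideal.span_le.2 fun q hq => ?_
      obtain ⟨x, rfl⟩ := SymmetricAlgebra.algHom_surjective ℂ _ q
      exact (RingQuot.mkAlgHom_rel ℂ (RestrRel.cov x hq)).trans (map_zero _)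

theorem vecHom_ι (v : V) :
    vecHom c (Ideal.Quotient.mk _ (SymmetricAlgebra.ι ℂ V v)) = vec c v :=
  congrArg (RingQuot.mkAlgHom ℂ (RestrRel c)) (RatCher.symVec_ι c v)

theorem covHom_ι (f : Module.Dual ℂ V) :
    covHom c (Ideal.Quotient.mk _ (SymmetricAlgebra.ι ℂ _ f)) = cov c f :=
  congrArg (RingQuot.mkAlgHom ℂ (RestrRel c)) (RatCher.symCov_ι c f)

/-- The product map from the smash product `S(V)_G ⋊ G`, realised on finitely supported functions
from `G` to `S(V)_G`, to the restricted Cherednik algebra. -/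
def smash : (G →₀ Coinvariant (natRep G)) →ₗ[ℂ] RestrCher c :=
  Finsupp.lsum ℂ fun g => LinearMap.mulRight ℂ (grp c g) ∘ₗ (vecHom c).toLinearMap

@[simp]
theorem smash_single (g : G) (p : Coinvariant (natRep G)) :
    smash c (Finsupp.single g p) = vecHom c p * grp c g := by
  simp [smash]

theorem toSubmodule_adjoin_range_grp :
    Subalgebra.toSubmodule (Algebra.adjoin ℂ (Set.range (grp c)))
      = Submodule.span ℂ (Set.range (grp c)) :=
  toSubmodule_adjoin_range_monoidHom (grpHom c)

theorem adjoin_vec_mul_adjoin_grp_le_range_smash :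
    Subalgebra.toSubmodule (Algebra.adjoin ℂ (Set.range (vec c)))
      * Subalgebra.toSubmodule (Algebra.adjoin ℂ (Set.range (grp c)))
      ≤ LinearMap.range (smash c) := by
  have hvec : Algebra.adjoin ℂ (Set.range (vec c)) ≤ (vecHom c).range :=
    Algebra.adjoin_le fun _ ⟨v, hv⟩ => ⟨_, (vecHom_ι c v).trans hv⟩
  rw [toSubmodule_adjoin_range_grp]
  refine Submodule.mul_le.2 fun x hx y hy => ?_
  obtain ⟨p, rfl⟩ := hvec hx
  induction hy using Submodule.span_induction with
  | mem y hy =>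
    obtain ⟨g, rfl⟩ := hy
    exact ⟨Finsupp.single g p, smash_single c g p⟩
  | zero => rw [mul_zero]; exact zero_mem _
  | add y z _ _ hy hz => rw [mul_add]; exact add_mem hy hz
  | smul a y _ hy => rw [mul_smul_comm]; exact Submodule.smul_mem _ a hy

/-- The product map `S(V)_G ⊗ ℂG ⊗ S(V*)_G → H̄_{0,c}(G)`. -/
def triangular :
    (G →₀ Coinvariant (natRep G)) ⊗[ℂ] Coinvariant (natRep G).dual →ₗ[ℂ] RestrCher c :=
  LinearMap.mul' ℂ (RestrCher c) ∘ₗ TensorProduct.map (smash c) (covHom c).toLinearMap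

@[simp]
theorem triangular_tmul (a : G →₀ Coinvariant (natRep G)) (q : Coinvariant (natRep G).dual) :
    triangular c (a ⊗ₜ q) = smash c a * covHom c q :=
  rfl

theorem triangular_surjective : Function.Surjective (triangular c) := by
  have hcov : Algebra.adjoin ℂ (Set.range (cov c)) ≤ (covHom c).range :=
    Algebra.adjoin_le fun _ ⟨f, hf⟩ => ⟨_, (covHom_ι c f).trans hf⟩
  rw [← LinearMap.range_eq_top, ← top_le_iff, ← adjoin_vec_mul_adjoin_grp_mul_adjoin_cov c]
  refine Submodule.mul_le.2 fun x hx y hy => ?_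
  obtain ⟨a, rfl⟩ := adjoin_vec_mul_adjoin_grp_le_range_smash c hx
  obtain ⟨q, rfl⟩ := hcov hy
  exact ⟨a ⊗ₜ q, triangular_tmul c a q⟩

end RestrCher

namespace RootData

variable (R : RootData G)

/-- The action of `B(Y_G)` by multiplication on the left. -/
def opNichols : Nichols R.braiding →ₐ[ℂ] R.Op :=
  MonoidAlgebra.singleOneAlgHom.comp (Algebra.lmul ℂ (Nichols R.braiding))

theorem opRep_ofNichols (b : Nichols R.braiding) :
    R.opRep (HeisDouble.ofNichols R b) = R.opNichols b := by
  have hcomp : R.opRep.comp (HeisDouble.ofNichols R) = R.opNichols := by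
    refine Nichols.algHom_ext fun s => ?_
    rw [AlgHom.comp_apply, HeisDouble.ofNichols_gen, opRep_y]
    rfl
  exact DFunLike.congr_fun hcomp b

theorem opRep_ofNicholsDual (b : Nichols R.braidingᵀ) :
    R.opRep (HeisDouble.ofNicholsDual R b) = R.opDual b := by
  have hcomp : R.opRep.comp (HeisDouble.ofNicholsDual R) = R.opDual := by
    refine Nichols.algHom_ext fun s => ?_
    rw [AlgHom.comp_apply, HeisDouble.ofNicholsDual_gen, opRep_ystar, opDual_gen]
  exact DFunLike.congr_fun hcomp b

theorem opDual_mem_adjoin (b : Nichols R.braidingᵀ) :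
    R.opDual b ∈ Algebra.adjoin ℂ (Set.range R.opYstar) := by
  have hrange : R.opDual '' Set.range (Nichols.gen R.braidingᵀ) = Set.range R.opYstar := by
    rw [← Set.range_comp]
    exact congrArg Set.range (funext R.opDual_gen)
  rw [← hrange, ← AlgHom.map_adjoin]
  exact ⟨b, Nichols.mem_adjoin_range_gen b, rfl⟩

/-- The action of the smash product `B(Y_G) ⋊ G`, realised on finitely supported functions. -/
def opSmash : (G →₀ Nichols R.braiding) →ₗ[ℂ] R.Op :=
  Finsupp.lsum ℂ fun g => LinearMap.mulRight ℂ (R.opGrp g) ∘ₗ R.opNichols.toLinearMap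

theorem opSmash_single (g : G) (b : Nichols R.braiding) : R.opSmash (Finsupp.single g b)
    = MonoidAlgebra.single g (LinearMap.mulLeft ℂ b * (R.act g).toLinearMap) := by
  have : R.opNichols b * R.opGrp g
      = MonoidAlgebra.single g (LinearMap.mulLeft ℂ b * (R.act g).toLinearMap) :=
    (MonoidAlgebra.single_mul_single ..).trans (by rw [one_mul]; rfl)
  simpa [opSmash] using this

theorem evalOne_opSmash (a : G →₀ Nichols R.braiding) : R.evalOne (R.opSmash a) = a := by
  classical
  suffices R.evalOne ∘ₗ R.opSmash = LinearMap.id from DFunLike.congr_fun this a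
  refine Finsupp.lhom_ext fun g b => ?_
  ext h
  rw [LinearMap.comp_apply, opSmash_single, evalOne_apply, MonoidAlgebra.coeff_single,
    LinearMap.id_apply, Finsupp.single_apply, Finsupp.single_apply]
  split_ifs <;> simp

theorem mulLeft_mul_act_mul_mulGen (g : G) (b : Nichols R.braiding) (s : Refl G) :
    LinearMap.mulLeft ℂ b * (R.act g).toLinearMap * R.mulGen s = R.cocycle g s •
      (R.mulGen (s.conj g) * (LinearMap.mulLeft ℂ b * (R.act g).toLinearMap)) := by
  ext x
  simp [mulGen_apply, mul_assoc]

theorem opDeriv_opSmash_mul (s : Refl G) (a : G →₀ Nichols R.braiding) (p : R.Op) :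
    R.opDeriv s (R.opSmash a * p) = R.opSmash a * R.opDeriv s p := by
  induction a using Finsupp.induction_linear with
  | zero => simp
  | add a b ha hb => rw [map_add, add_mul, map_add, ha, hb, add_mul]
  | single g b =>
    induction p using MonoidAlgebra.induction_linear with
    | zero => simp
    | add p q hp hq => rw [mul_add, map_add, map_add, hp, hq, mul_add]
    | single h T =>
      rw [opSmash_single, MonoidAlgebra.single_mul_single, opDeriv_single, opDeriv_single,
        MonoidAlgebra.single_mul_single, mul_assoc g, cocycle_mul, Refl.conj_mul,
        mul_comm (R.cocycle g _), mul_smul, ← mul_assoc (R.mulGen _),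
        ← smul_mul_assoc (R.cocycle g _), ← mulLeft_mul_act_mul_mulGen, mul_sub, mul_smul_comm,
        mul_assoc _ T, mul_assoc _ (R.mulGen _)]

theorem restrCherHom_vecHom {c : Refl G → ℂ} (hc : ∀ g s, c (s.conj g) = c s)
    (p : Coinvariant (natRep G)) :
    R.restrCherHom hc (RestrCher.vecHom c p) = R.heisVec hc p := by
  obtain ⟨p, rfl⟩ := Ideal.Quotient.mk_surjective p
  obtain ⟨x, rfl⟩ := SymmetricAlgebra.algHom_surjective ℂ V p
  exact (RingQuot.liftAlgHom_mkAlgHom_apply ..).trans (R.ratCherHom_lift_vec hc x)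

theorem restrCherHom_covHom {c : Refl G → ℂ} (hc : ∀ g s, c (s.conj g) = c s)
    (q : Coinvariant (natRep G).dual) :
    R.restrCherHom hc (RestrCher.covHom c q) = R.heisCov q := by
  obtain ⟨q, rfl⟩ := Ideal.Quotient.mk_surjective q
  obtain ⟨x, rfl⟩ := SymmetricAlgebra.algHom_surjective ℂ _ q
  exact (RingQuot.liftAlgHom_mkAlgHom_apply ..).trans (R.ratCherHom_lift_cov hc x)

theorem opRep_restrCherHom_smash {c : Refl G → ℂ} (hc : ∀ g s, c (s.conj g) = c s)
    (a : G →₀ Coinvariant (natRep G)) :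
    R.opRep (R.restrCherHom hc (RestrCher.smash c a))
      = R.opSmash (Finsupp.mapRange.linearMap (R.coinvariantHom hc).toLinearMap a) := by
  induction a using Finsupp.induction_linear with
  | zero => simp only [map_zero]
  | add a b ha hb => simp only [map_add, ha, hb]
  | single g p =>
    rw [RestrCher.smash_single, map_mul, map_mul, restrCherHom_vecHom, restrCherHom_grp, heisVec,
      AlgHom.comp_apply, opRep_ofNichols, opRep_grp, Finsupp.mapRange.linearMap_apply,
      Finsupp.mapRange_single, opSmash, Finsupp.lsum_single]
    rfl

theorem opRep_restrCherHom_triangular {c : Refl G → ℂ} (hc : ∀ g s, c (s.conj g) = c s)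
    (a : G →₀ Coinvariant (natRep G)) (q : Coinvariant (natRep G).dual) :
    R.opRep (R.restrCherHom hc (RestrCher.triangular c (a ⊗ₜ q)))
      = R.opSmash (Finsupp.mapRange.linearMap (R.coinvariantHom hc).toLinearMap a)
        * R.opDual (R.dualCoinvariantHom q) := by
  rw [RestrCher.triangular_tmul, map_mul, map_mul, opRep_restrCherHom_smash, restrCherHom_covHom,
    heisCov, AlgHom.comp_apply, opRep_ofNicholsDual]

theorem restrCherHom_injective {c : Refl G → ℂ} (hc : ∀ g s, c (s.conj g) = c s)
    (hc' : Subgroup.closure {g : G | ∃ s : Refl G, s.1 = g ∧ c s ≠ 0} = ⊤) :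
    Function.Injective (R.restrCherHom hc) := by
  have hrefl : Subgroup.closure {g : G | IsReflection g} = ⊤ :=
    top_unique (hc' ▸ Subgroup.closure_mono fun g ⟨s, hs, _⟩ => hs ▸ s.2)
  let κ := Finsupp.mapRange.linearMap (α := G) (R.coinvariantHom hc).toLinearMap
  have hκ : Function.Injective κ :=
    Finsupp.mapRange_injective _ (map_zero _) (R.coinvariantHom_injective hc hc')
  refine (injective_iff_map_eq_zero _).2 fun x hx => ?_
  obtain ⟨z, rfl⟩ := RestrCher.triangular_surjective c x
  let b := Module.Basis.ofVectorSpace ℂ (G →₀ Coinvariant (natRep G))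
  obtain ⟨q, rfl⟩ := TensorProduct.eq_repr_basis_left b z
  have hlin : LinearIndependent ℂ fun k => R.evalOne (R.opSmash (κ (b k))) := by
    simp only [evalOne_opSmash]
    exact b.linearIndependent.map' κ (LinearMap.ker_eq_bot.2 hκ)
  have hsum : ∑ k ∈ q.support, R.opSmash (κ (b k)) * R.opDual (R.dualCoinvariantHom (q k)) = 0 := by
    rw [← map_zero R.opRep, ← hx, Finsupp.sum, map_sum, map_sum, map_sum]
    simp only [opRep_restrCherHom_triangular, κ]
  have hq := R.isBraidedDerivation_opDeriv.eq_zero_of_sum_mul_eq_zero R.evalOne_mul_opYstar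
    R.eq_zero_of_opDeriv_eq_zero hlin (fun s k p => R.opDeriv_opSmash_mul s _ p)
    (fun k _ => R.opDual_mem_adjoin _) hsum
  refine (congrArg _ (Finset.sum_eq_zero fun k hk => ?_)).trans (map_zero _)
  rw [(map_eq_zero_iff _ (R.dualCoinvariantHom_injective hrefl)).1
    ((map_eq_zero_iff _ R.opDual_injective).1 (hq k hk))]
  exact TensorProduct.tmul_zero _ _

end RootData

end Injectivity

end Cherednik

end

theorem mainTheorem2_general {V : Type*} [AddCommGroup V] [Module ℂ V]
    (G : Subgroup (LinearMap.GeneralLinearGroup ℂ V)) [Finite G]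
    (R : RootData G) (c : Refl G → ℂ) (hc : ∀ (g : G) (s : Refl G), c (s.conj g) = c s) :
    (∃ M : RestrCher c →ₐ[ℂ] HeisDouble R,
      (∀ v : V, M (RestrCher.vec c v) =
        ∑ s : Refl G, (c s * R.root s v) • HeisDouble.y R s) ∧
      (∀ f : Module.Dual ℂ V, M (RestrCher.cov c f) =
        ∑ s : Refl G, f (R.coroot s) • HeisDouble.ystar R s) ∧
      (∀ g : G, M (RestrCher.grp c g) = HeisDouble.grp R g) ∧
      (Subgroup.closure {g : G | ∃ s : Refl G, s.1 = g ∧ c s ≠ 0} = ⊤ → Function.Injective M)) ∧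
    (∃ m : Coinvariant (natRep G) →ₐ[ℂ] Nichols R.braiding,
      (∀ v : V, m (Ideal.Quotient.mk _ (SymmetricAlgebra.ι ℂ V v)) =
        ∑ s : Refl G, (c s * R.root s v) • Nichols.gen R.braiding s) ∧
      (Subgroup.closure {g : G | ∃ s : Refl G, s.1 = g ∧ c s ≠ 0} = ⊤ → Function.Injective m)) :=
  ⟨⟨R.restrCherHom hc,
      fun v => (R.restrCherHom_vec hc v).trans (R.rootSum_apply c _ v),
      fun f => (R.restrCherHom_cov hc f).trans (R.corootSum_apply _ f),
      R.restrCherHom_grp hc,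
      R.restrCherHom_injective hc⟩,
    R.coinvariantHom hc,
    fun v => (R.coinvariantHom_ι hc v).trans (R.rootSum_apply c _ v),
    R.coinvariantHom_injective hc⟩

theorem mainTheorem2 {V : Type*} [AddCommGroup V] [Module ℂ V] [FiniteDimensional ℂ V]
    (G : Subgroup (LinearMap.GeneralLinearGroup ℂ V)) [Finite G]
    (hirr : (natRep G).IsIrreducible)
    (hgen : Subgroup.closure {s : G | IsReflection s} = ⊤)
    (R : RootData G) (c : Refl G → ℂ) (hc : ∀ (g : G) (s : Refl G), c (s.conj g) = c s) :
    (∃ M : RestrCher c →ₐ[ℂ] HeisDouble R,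
      (∀ v : V, M (RestrCher.vec c v) =
        ∑ s : Refl G, (c s * R.root s v) • HeisDouble.y R s) ∧
      (∀ f : Module.Dual ℂ V, M (RestrCher.cov c f) =
        ∑ s : Refl G, f (R.coroot s) • HeisDouble.ystar R s) ∧
      (∀ g : G, M (RestrCher.grp c g) = HeisDouble.grp R g) ∧
      ((∀ s, c s ≠ 0) → Function.Injective M) ∧
      (Subgroup.closure {g : G | ∃ s : Refl G, s.1 = g ∧ c s ≠ 0} = ⊤ → Function.Injective M)) ∧
    (∃ m : Coinvariant (natRep G) →ₐ[ℂ] Nichols R.braiding,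
      (∀ v : V, m (Ideal.Quotient.mk _ (SymmetricAlgebra.ι ℂ V v)) =
        ∑ s : Refl G, (c s * R.root s v) • Nichols.gen R.braiding s) ∧
      ((∀ s, c s ≠ 0) → Function.Injective m) ∧
      (Subgroup.closure {g : G | ∃ s : Refl G, s.1 = g ∧ c s ≠ 0} = ⊤ → Function.Injective m)) := by
  have hgen' (h : ∀ s, c s ≠ 0) :
      Subgroup.closure {g : G | ∃ s : Refl G, s.1 = g ∧ c s ≠ 0} = ⊤ :=
    top_unique (hgen ▸ Subgroup.closure_mono fun g hg => ⟨⟨g, hg⟩, rfl, h _⟩)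
  obtain ⟨⟨M, hvec, hcov, hgrp, hM⟩, m, hm_vec, hm⟩ := mainTheorem2_general G R c hc
  exact ⟨⟨M, hvec, hcov, hgrp, hM ∘ hgen', hM⟩, m, hm_vec, hm ∘ hgen', hm⟩
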